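/- **Setting.** Let $(M,g)$ be a smooth 4-dimensional space-time and let $U\subseteq M$ be an open set carrying a smooth orthonormal tetrad $(e_0,e_1,e_2,e_3)$, so that $g_{ab}=g(e_a,e_b)=\mathrm{diag}(-1,1,1,1)$. All components below are tetrad components and $u=e_0$ is the unit tangent field of a timelike congruence. The commutation coefficients $\gamma^c{}_{ab}$ are defined by $[e_a,e_b]=\gamma^c{}_{ab}e_c$. The Levi-Civita connection $\nabla_{e_b}e_a=\Gamma^c{}_{ab}e_c$ is given by $\Gamma_{cab}=\tfrac12(\gamma_{bca}+\gamma_{acb}-\gamma_{cab})$. Its curvature is $$\mathcal R^a{}_{bcd}=e_c(\Gamma^a{}_{bd})-e_d(\Gamma^a{}_{bc})+\Gamma^f{}_{bd}\Gamma^a{}_{fc}-\Gamma^f{}_{bc}\Gamma^a{}_{fd}-\gamma^f{}_{cd}\Gamma^a{}_{bf},$$ with Ricci tensor $\mathcal R_{bd}=\mathcal R^c{}_{bcd}$ and scalar curvature $\mathcal R=g^{bd}\mathcal R_{bd}$. Put $h_{ab}=g_{ab}+u_au_b$ and decompose $$u_{a;b}=-\dot u_au_b+\sigma_{ab}+\tfrac13\theta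 h_{ab}+\omega_{ab},\qquad \dot u_a=u_{a;b}u^b,\quad \theta=u^a{}_{;a},$$ where $\sigma_{ab}$ is symmetric and trace-free, $\omega_{ab}$ is antisymmetric, and both are orthogonal to $u$. Let $\eta_{abcd}$ be the totally antisymmetric tensor with $\eta_{0123}=-1$, and let $\varepsilon_{abc}=\eta_{abcd}u^d$. Let $E_{ab},H_{ab},T_{ab}$ be smooth symmetric tensor fields on $U$, with $E$ and $H$ trace-free and orthogonal to $u$. Define $R_{abcd}=R_{abcd}(E,H,T)$ by $$R_{abcd}=C_{abcd}+g_{a[c}S_{d]b}+g_{b[d}S_{c]a}-\tfrac13 S\,g_{a[c}g_{d]b},\qquad S_{ab}=T_{ab}-\tfrac12T^c{}_c\,g_{ab},\quad S=S^a{}_a,$$ $$C_{ab}{}^{cd}=4\big(u_{[a}u^{[c}+h_{[a}{}^{[c}\big)E_{b]}{}^{d]}+2\varepsilon_{abe}u^{[c}H^{d]e}+2\varepsilon^{cde}u_{[a}H_{b]e}.$$ The *Jacobi–Ricci–Bianchi (JRB) system* for $(e_a,\gamma,E,H,T)$ consists of * the Jacobi equations $e_{[a}\gamma^d{}_{bc]}-\gamma^d{}_{f[a}\gamma^f{}_{bc]}=0$,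 * the Ricci equations for $u$, $u^a{}_{;c;d}-u^a{}_{;d;c}=R^a{}_{bdc}u^b$, * the second Bianchi equations $R^a{}_{b[cd;e]}=0$, with $R=R(E,H,T)$. The Einstein field equations are $\mathcal R_{ab}-\tfrac12\mathcal R g_{ab}=T_{ab}$. **Theorem.** Suppose that at every point of $U$ the acceleration $\dot u$ is nonzero and is not an eigenvector of $\sigma^a{}_b+\omega^a{}_b$. Then the Einstein field equations are integrability conditions of the JRB system, in the following sense. 1. For all $E,H,T$ as above, the JRB system holds on $U$ if and only if the Einstein field equations hold on $U$ and $E_{ab}$, $H_{ab}$ are the electric and magnetic parts $C_{acbd}u^cu^d$ and $\tfrac12\eta_{ac}{}^{ef}C_{efbd}u^cu^d$ of the Weyl tensor $C_{abcd}$ of $\mathcal R_{abcd}$. In particular, every solution of the JRB system satisfies the Einstein field equations. 2. For all $E,H,T$ as above and every $x\in U$: if the JRB equations hold at $x$, and the first derivatives at $x$ of the Jacobi and Ricci equations also hold, then the Einstein field equations hold at $x$. 3. The curvature tensor $\mathcal R^a{}_{bcd}$ is the unique smooth tensor field $R^a{}_{bcd}$ on $U$ that has the symmetries $R_{abcd}=-R_{bacd}=-R_{abdc}=R_{cdab}$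 and satisfies the first Bianchi equations $R_{a[bcd]}=0$, the second Bianchi equations $R^a{}_{b[cd;e]}=0$, and the Ricci equations for $u$. -/

import Mathlib

open scoped Manifold ContDiff

noncomputable section

namespace JRB

/-! ### Tensor algebra in an orthonormal tetrad

Tetrad indices are elements of `Fin 4`, the index `0` being the timelike one.  An array
`Fin 4 → ⋯ → ℝ` holds the tetrad components of a tensor at one point. -/

/-- The constant tetrad components `g_ab = diag(-1, 1, 1, 1)` of the metric.  The array is its own
inverse, so it also gives `g^ab`. -/
def eta (a b : Fin 4) : ℝ := if a = b then (if a = 0 then -1 else 1) else 0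

/-- Contravariant components of `u = e_0`. -/
def uUp (a : Fin 4) : ℝ := if a = 0 then 1 else 0

/-- Covariant components `u_a = g_ab u^b`. -/
def uLow (a : Fin 4) : ℝ := ∑ b, eta a b * uUp b

/-- `h_ab = g_ab + u_a u_b`. -/
def hLow (a b : Fin 4) : ℝ := eta a b + uLow a * uLow b

/-- The mixed projector `h_a^b`. -/
def hMix (a b : Fin 4) : ℝ := ∑ c, eta b c * hLow a c

/-- The Levi-Civita tensor `η_abcd`, totally antisymmetric with `η_0123 = -1`. -/
def leviCivita (a b c d : Fin 4) : ℝ :=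
  -(((Matrix.of fun i j : Fin 4 => if ![a, b, c, d] i = j then (1 : ℤ) else 0).det : ℤ) : ℝ)

/-- `ε_abc = η_abcd u^d`. -/
def eps (a b c : Fin 4) : ℝ := ∑ d, leviCivita a b c d * uUp d

/-- Total antisymmetrization `F_[abc]`. -/
def alt3 (F : Fin 4 → Fin 4 → Fin 4 → ℝ) (a b c : Fin 4) : ℝ :=
  (1 / 6) * (F a b c + F b c a + F c a b - F b a c - F a c b - F c b a)

/-- Lowering the first index, `R_abcd = g_ae R^e_bcd`. -/
def lower (R : Fin 4 → Fin 4 → Fin 4 → Fin 4 → ℝ) (a b c d : Fin 4) : ℝ :=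
  ∑ e, eta a e * R e b c d

/-- Raising the first index, `R^a_bcd = g^ae R_ebcd`. -/
def raise (R : Fin 4 → Fin 4 → Fin 4 → Fin 4 → ℝ) (a b c d : Fin 4) : ℝ :=
  ∑ e, eta a e * R e b c d

/-- The trace `g^ab S_ab`. -/
def trace2 (S : Fin 4 → Fin 4 → ℝ) : ℝ := ∑ a, ∑ b, eta a b * S a b

/-- `R_bd = R^c_bcd`, for `R` with its first index up. -/
def ricci (R : Fin 4 → Fin 4 → Fin 4 → Fin 4 → ℝ) (b d : Fin 4) : ℝ := ∑ c, R c b c d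

/-- `g_a[c S_d]b + g_b[d S_c]a - (1/3) S g_a[c g_d]b`, where `S` also denotes the trace: for the
Ricci tensor `S` this is the Riemann tensor minus the Weyl tensor. -/
def ricciPart (S : Fin 4 → Fin 4 → ℝ) (a b c d : Fin 4) : ℝ :=
  (1 / 2) * (eta a c * S d b - eta a d * S c b) + (1 / 2) * (eta b d * S c a - eta b c * S d a)
    - (1 / 3) * trace2 S * ((1 / 2) * (eta a c * eta d b - eta a d * eta c b))

/-- The Weyl tensor `C_abcd` of a curvature tensor `R^a_bcd`. -/
def weyl (R : Fin 4 → Fin 4 → Fin 4 → Fin 4 → ℝ) (a b c d : Fin 4) : ℝ :=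
  lower R a b c d - ricciPart (ricci R) a b c d

/-- Electric part `C_acbd u^c u^d`. -/
def electric (C : Fin 4 → Fin 4 → Fin 4 → Fin 4 → ℝ) (a b : Fin 4) : ℝ :=
  ∑ c, ∑ d, C a c b d * uUp c * uUp d

/-- Magnetic part `(1/2) η_ac^ef C_efbd u^c u^d`. -/
def magnetic (C : Fin 4 → Fin 4 → Fin 4 → Fin 4 → ℝ) (a b : Fin 4) : ℝ :=
  (1 / 2) * ∑ c, ∑ d, ∑ e, ∑ f, ∑ m, ∑ n,
    leviCivita a c m n * eta m e * eta n f * C e f b d * uUp c * uUp d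

/-- The Weyl tensor built from `E` and `H`:
`C_abcd = 4 (u_[a u_[c + h_[a [c) E_b] d] + 2 ε_abe u_[c H_d]^e + 2 ε_cde u_[a H_b]^e`. -/
def weylOf (E H : Fin 4 → Fin 4 → ℝ) (a b c d : Fin 4) : ℝ :=
  (uLow a * uLow c + hLow a c) * E b d - (uLow b * uLow c + hLow b c) * E a d
    - (uLow a * uLow d + hLow a d) * E b c + (uLow b * uLow d + hLow b d) * E a c
    + (∑ e, ∑ f, eps a b e * eta e f * (uLow c * H d f - uLow d * H c f))
    + (∑ e, ∑ f, eps c d e * eta e f * (uLow a * H b f - uLow b * H a f))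

/-- The Ricci tensor that the field equations assign to `T`, namely `T_ab - (1/2) T g_ab`. -/
def ricciOf (T : Fin 4 → Fin 4 → ℝ) (a b : Fin 4) : ℝ := T a b - (1 / 2) * trace2 T * eta a b

/-- The tensor `R^a_bcd` built from `E`, `H` and `T`. -/
def riemannOf (E H T : Fin 4 → Fin 4 → ℝ) : Fin 4 → Fin 4 → Fin 4 → Fin 4 → ℝ :=
  raise fun a b c d => weylOf E H a b c d + ricciPart (ricciOf T) a b c d

/-- The Einstein field equations `R_ab - (1/2) R g_ab = T_ab` at a point, for the curvature tensor
`R^a_bcd`. -/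
def EinsteinEq (R : Fin 4 → Fin 4 → Fin 4 → Fin 4 → ℝ) (T : Fin 4 → Fin 4 → ℝ) : Prop :=
  ∀ a b, ricci R a b - (1 / 2) * trace2 (ricci R) * eta a b = T a b

/-! ### Tetrads and their Levi-Civita connection -/

variable {M : Type*} [TopologicalSpace M] [ChartedSpace (EuclideanSpace ℝ (Fin 4)) M]

/-- The functions `e_0, …, e_3` are smooth vector fields on `U` which are orthonormal for `g`, and
the `γ x c a b = γ^c_ab` are their (smooth) commutation coefficients,
`[e_a, e_b] = γ^c_ab e_c`. -/
structure IsTetrad [IsManifold (𝓡 4) ∞ M] (U : Set M)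
    (g : ∀ x : M, LinearMap.BilinForm ℝ (TangentSpace (𝓡 4) x))
    (e : Fin 4 → ∀ x : M, TangentSpace (𝓡 4) x)
    (γ : M → Fin 4 → Fin 4 → Fin 4 → ℝ) : Prop where
  smooth : ∀ a, ContMDiffOn (𝓡 4) (𝓡 4).tangent ∞
    (fun x => (⟨x, e a x⟩ : TangentBundle (𝓡 4) M)) U
  orthonormal : ∀ x ∈ U, ∀ a b, g x (e a x) (e b x) = eta a b
  smooth_comm : ∀ c a b, ContMDiffOn (𝓡 4) 𝓘(ℝ, ℝ) ∞ (fun x => γ x c a b) U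
  comm : ∀ x ∈ U, ∀ a b, VectorField.mlieBracket (𝓡 4) (e a) (e b) x = ∑ c, γ x c a b • e c x

/-- The directional derivative `e_a f`. -/
def dirD (e : Fin 4 → ∀ x : M, TangentSpace (𝓡 4) x) (a : Fin 4) (f : M → ℝ) (x : M) : ℝ :=
  mfderiv (𝓡 4) 𝓘(ℝ, ℝ) f x (e a x)

/-- The connection coefficients with all indices down,
`Γ_cab = (1/2) (γ_bca + γ_acb - γ_cab)`. -/
def connLow (γ : M → Fin 4 → Fin 4 → Fin 4 → ℝ) (x : M) (c a b : Fin 4) : ℝ :=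
  (1 / 2) * ∑ d, (eta b d * γ x d c a + eta a d * γ x d c b - eta c d * γ x d a b)

/-- The connection coefficients `Γ^c_ab` of the Levi-Civita connection,
`∇_{e_b} e_a = Γ^c_ab e_c`. -/
def conn (γ : M → Fin 4 → Fin 4 → Fin 4 → ℝ) (x : M) (c a b : Fin 4) : ℝ :=
  ∑ d, eta c d * connLow γ x d a b

/-- The curvature tensor `R^a_bcd` of the connection (second Cartan equations). -/
def curv (e : Fin 4 → ∀ x : M, TangentSpace (𝓡 4) x) (γ : M → Fin 4 → Fin 4 → Fin 4 → ℝ)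
    (x : M) (a b c d : Fin 4) : ℝ :=
  dirD e c (fun y => conn γ y a b d) x - dirD e d (fun y => conn γ y a b c) x
    + ∑ f, (conn γ x f b d * conn γ x a f c - conn γ x f b c * conn γ x a f d
      - γ x f c d * conn γ x a b f)

/-- `w^a_;c`. -/
def covD1 (e : Fin 4 → ∀ x : M, TangentSpace (𝓡 4) x) (γ : M → Fin 4 → Fin 4 → Fin 4 → ℝ)
    (w : M → Fin 4 → ℝ) (x : M) (a c : Fin 4) : ℝ :=
  dirD e c (fun y => w y a) x + ∑ f, conn γ x a f c * w x f

/-- `S^a_b;c`. -/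
def covD11 (e : Fin 4 → ∀ x : M, TangentSpace (𝓡 4) x) (γ : M → Fin 4 → Fin 4 → Fin 4 → ℝ)
    (S : M → Fin 4 → Fin 4 → ℝ) (x : M) (a b c : Fin 4) : ℝ :=
  dirD e c (fun y => S y a b) x + ∑ f, (conn γ x a f c * S x f b - conn γ x f b c * S x a f)

/-- `R^a_bcd;k`. -/
def covD13 (e : Fin 4 → ∀ x : M, TangentSpace (𝓡 4) x) (γ : M → Fin 4 → Fin 4 → Fin 4 → ℝ)
    (R : M → Fin 4 → Fin 4 → Fin 4 → Fin 4 → ℝ) (x : M) (a b c d k : Fin 4) : ℝ :=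
  dirD e k (fun y => R y a b c d) x
    + ∑ f, (conn γ x a f k * R x f b c d - conn γ x f b k * R x a f c d
      - conn γ x f c k * R x a b f d - conn γ x f d k * R x a b c f)

/-! ### Kinematics of the congruence `u = e_0` -/

/-- `u^a_;b`. -/
def gradU (e : Fin 4 → ∀ x : M, TangentSpace (𝓡 4) x) (γ : M → Fin 4 → Fin 4 → Fin 4 → ℝ)
    (x : M) (a b : Fin 4) : ℝ :=
  covD1 e γ (fun _ => uUp) x a b

/-- The acceleration, with its index up: `u^a_;b u^b`. -/
def accel (e : Fin 4 → ∀ x : M, TangentSpace (𝓡 4) x) (γ : M → Fin 4 → Fin 4 → Fin 4 → ℝ)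
    (x : M) (a : Fin 4) : ℝ :=
  ∑ b, gradU e γ x a b * uUp b

/-- The expansion scalar `θ = u^a_;a`. -/
def expansion (e : Fin 4 → ∀ x : M, TangentSpace (𝓡 4) x) (γ : M → Fin 4 → Fin 4 → Fin 4 → ℝ)
    (x : M) : ℝ :=
  ∑ a, gradU e γ x a a

/-- The projected gradient `h_a^c h_b^d u_c;d`. -/
def projGrad (e : Fin 4 → ∀ x : M, TangentSpace (𝓡 4) x) (γ : M → Fin 4 → Fin 4 → Fin 4 → ℝ)
    (x : M) (a b : Fin 4) : ℝ :=
  ∑ c, ∑ d, hMix a c * hMix b d * ∑ f, eta c f * gradU e γ x f d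

/-- The shear `σ_ab`. -/
def shear (e : Fin 4 → ∀ x : M, TangentSpace (𝓡 4) x) (γ : M → Fin 4 → Fin 4 → Fin 4 → ℝ)
    (x : M) (a b : Fin 4) : ℝ :=
  (1 / 2) * (projGrad e γ x a b + projGrad e γ x b a) - (1 / 3) * expansion e γ x * hLow a b

/-- The vorticity `ω_ab`. -/
def vorticity (e : Fin 4 → ∀ x : M, TangentSpace (𝓡 4) x) (γ : M → Fin 4 → Fin 4 → Fin 4 → ℝ)
    (x : M) (a b : Fin 4) : ℝ :=
  (1 / 2) * (projGrad e γ x a b - projGrad e γ x b a)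

/-- The endomorphism `σ^a_b + ω^a_b`. -/
def shearVorticity (e : Fin 4 → ∀ x : M, TangentSpace (𝓡 4) x)
    (γ : M → Fin 4 → Fin 4 → Fin 4 → ℝ) (x : M) : Matrix (Fin 4) (Fin 4) ℝ :=
  Matrix.of fun a b => ∑ c, eta a c * (shear e γ x c b + vorticity e γ x c b)

/-- The acceleration is nonzero at `x` and is not an eigenvector of `σ^a_b + ω^a_b`. -/
def Generic (e : Fin 4 → ∀ x : M, TangentSpace (𝓡 4) x) (γ : M → Fin 4 → Fin 4 → Fin 4 → ℝ)
    (x : M) : Prop :=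
  accel e γ x ≠ 0 ∧
    ¬ ∃ μ : ℝ, Module.End.HasEigenvector (Matrix.toLin' (shearVorticity e γ x)) μ (accel e γ x)

/-! ### The Jacobi, Ricci and Bianchi equations

Each family of equations is given by its residual, so that the equations read `residual = 0`. -/

/-- `e_[a γ^d_bc] - γ^d_f[a γ^f_bc]`. -/
def jacobiRes (e : Fin 4 → ∀ x : M, TangentSpace (𝓡 4) x) (γ : M → Fin 4 → Fin 4 → Fin 4 → ℝ)
    (d a b c : Fin 4) (x : M) : ℝ :=
  alt3 (fun a b c => dirD e a (fun y => γ y d b c) x - ∑ f, γ x d f a * γ x f b c) a b c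

/-- `u^a_;c;d - u^a_;d;c - R^a_bdc u^b`. -/
def ricciRes (e : Fin 4 → ∀ x : M, TangentSpace (𝓡 4) x) (γ : M → Fin 4 → Fin 4 → Fin 4 → ℝ)
    (R : M → Fin 4 → Fin 4 → Fin 4 → Fin 4 → ℝ) (a c d : Fin 4) (x : M) : ℝ :=
  covD11 e γ (gradU e γ) x a c d - covD11 e γ (gradU e γ) x a d c - ∑ b, R x a b d c * uUp b

/-- `R^a_b[cd;k]`. -/
def bianchiRes (e : Fin 4 → ∀ x : M, TangentSpace (𝓡 4) x) (γ : M → Fin 4 → Fin 4 → Fin 4 → ℝ)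
    (R : M → Fin 4 → Fin 4 → Fin 4 → Fin 4 → ℝ) (a b c d k : Fin 4) (x : M) : ℝ :=
  alt3 (fun c d k => covD13 e γ R x a b c d k) c d k

/-- The variables `E`, `H`, `T` of the extended formalism on `U`: smooth symmetric tensor fields,
`E` and `H` being also trace-free and orthogonal to `u`. -/
structure IsExtendedVars (U : Set M) (E H T : M → Fin 4 → Fin 4 → ℝ) : Prop where
  smooth_E : ∀ a b, ContMDiffOn (𝓡 4) 𝓘(ℝ, ℝ) ∞ (fun x => E x a b) U
  smooth_H : ∀ a b, ContMDiffOn (𝓡 4) 𝓘(ℝ, ℝ) ∞ (fun x => H x a b) U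
  smooth_T : ∀ a b, ContMDiffOn (𝓡 4) 𝓘(ℝ, ℝ) ∞ (fun x => T x a b) U
  symm_E : ∀ x ∈ U, ∀ a b, E x a b = E x b a
  symm_H : ∀ x ∈ U, ∀ a b, H x a b = H x b a
  symm_T : ∀ x ∈ U, ∀ a b, T x a b = T x b a
  trace_E : ∀ x ∈ U, trace2 (E x) = 0
  trace_H : ∀ x ∈ U, trace2 (H x) = 0
  orth_E : ∀ x ∈ U, ∀ a, ∑ b, E x a b * uUp b = 0
  orth_H : ∀ x ∈ U, ∀ a, ∑ b, H x a b * uUp b = 0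

/-- The Jacobi–Ricci–Bianchi system at the point `x`, for a tensor field `R^a_bcd`. -/
structure SystemAt (e : Fin 4 → ∀ x : M, TangentSpace (𝓡 4) x)
    (γ : M → Fin 4 → Fin 4 → Fin 4 → ℝ)
    (R : M → Fin 4 → Fin 4 → Fin 4 → Fin 4 → ℝ) (x : M) : Prop where
  jacobi : ∀ d a b c, jacobiRes e γ d a b c x = 0
  ricci : ∀ a c d, ricciRes e γ R a c d x = 0
  bianchi : ∀ a b c d k, bianchiRes e γ R a b c d k x = 0

/-- The system at the point `x` together with the first derivatives at `x` of its Jacobi and Ricci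
equations. -/
structure ProlongedSystemAt (e : Fin 4 → ∀ x : M, TangentSpace (𝓡 4) x)
    (γ : M → Fin 4 → Fin 4 → Fin 4 → ℝ)
    (R : M → Fin 4 → Fin 4 → Fin 4 → Fin 4 → ℝ) (x : M) : Prop
    extends SystemAt e γ R x where
  deriv_jacobi : ∀ k d a b c, dirD e k (jacobiRes e γ d a b c) x = 0
  deriv_ricci : ∀ k a c d, dirD e k (ricciRes e γ R a c d) x = 0

/-- A smooth tensor field `R^a_bcd` on `U` with the symmetries of a Riemann tensor which satisfies
the first and second Bianchi equations and the Ricci equations for `u`. -/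
structure IsCurvatureLike (U : Set M) (e : Fin 4 → ∀ x : M, TangentSpace (𝓡 4) x)
    (γ : M → Fin 4 → Fin 4 → Fin 4 → ℝ)
    (R : M → Fin 4 → Fin 4 → Fin 4 → Fin 4 → ℝ) : Prop where
  smooth : ∀ a b c d, ContMDiffOn (𝓡 4) 𝓘(ℝ, ℝ) ∞ (fun x => R x a b c d) U
  antisymm_left : ∀ x ∈ U, ∀ a b c d, lower (R x) a b c d = -lower (R x) b a c d
  antisymm_right : ∀ x ∈ U, ∀ a b c d, lower (R x) a b c d = -lower (R x) a b d c
  symm_pair : ∀ x ∈ U, ∀ a b c d, lower (R x) a b c d = lower (R x) c d a b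
  bianchi_first : ∀ x ∈ U, ∀ a b c d, alt3 (fun b c d => lower (R x) a b c d) b c d = 0
  bianchi_second : ∀ x ∈ U, ∀ a b c d k, bianchiRes e γ R a b c d k x = 0
  ricci : ∀ x ∈ U, ∀ a c d, ricciRes e γ R a c d x = 0

end JRB

end

/-! Let `L` be the difference of a solution `R` and the curvature `curv`. The Ricci equations for
`u`, compared with the Ricci identity, say that `L` vanishes as soon as one index is contracted with
`u`. Their first derivatives say the same of the derivatives of these components. Subtract the
second Bianchi identities of `R` and `curv` with the second index equal to `0`: the derivatives
cancel, and the only connection terms left are those acting on that index. What remains is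
algebraic, `u^f_;[k L^a_|f|cd] = 0`.

Since `L` is orthogonal to `u`, it amounts to a symmetric spatial 3×3 matrix `P`, its double dual.
With `v` the acceleration and `K` the spatial part of `∇u`, the components with one form index equal
to `0` say that the columns of `P` are parallel to `v`, so `P = λ v vᵀ`. The purely spatial
component says that `K P` is symmetric, so `λ ≠ 0` would make `v` an eigenvector of `K`. The
expansion only shifts eigenvalues of `σ + ω`, so genericity forces `P = 0` and `R = curv`.

The analytic step is `IsTetrad.eq_curv`, the algebraic one `IsBivectorForm.eq_zero_of_contraction`.
That `curv` itself has all the required properties is `IsTetrad.isCurvatureLike_curv` and rests on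
the Jacobi identity of the frame. The passage between `curv` and the variables `E`, `H`, `T` is the
pointwise Weyl–Ricci decomposition: `ricci_riemannOf`, `weyl_riemannOf` and `eq_riemannOf`. -/

namespace JRB

open VectorField

/-! ### Directional derivatives of functions. -/

section Calculus

variable {M : Type*} [TopologicalSpace M] [ChartedSpace (EuclideanSpace ℝ (Fin 4)) M]
  (e : Fin 4 → ∀ x : M, TangentSpace (𝓡 4) x) (a : Fin 4) {f g : M → ℝ} {x : M}

lemma dirD_eq_mvfderiv (f : M → ℝ) (x : M) :
    dirD e a f x = mvfderiv (𝓡 4) f x (e a x) := rfl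

lemma dirD_congr (h : f =ᶠ[nhds x] g) : dirD e a f x = dirD e a g x := by
  simp only [dirD, h.mfderiv_eq]
  rfl

@[simp] lemma dirD_const (c : ℝ) (x : M) : dirD e a (fun _ => c) x = 0 := by
  simp [dirD_eq_mvfderiv, mvfderiv_const]

lemma dirD_add (hf : MDifferentiableAt (𝓡 4) 𝓘(ℝ, ℝ) f x)
    (hg : MDifferentiableAt (𝓡 4) 𝓘(ℝ, ℝ) g x) :
    dirD e a (fun y => f y + g y) x = dirD e a f x + dirD e a g x := by
  simp only [dirD_eq_mvfderiv]
  change mvfderiv (𝓡 4) (f + g) x (e a x) = _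
  rw [mvfderiv_add hf hg]; rfl

lemma dirD_sub (hf : MDifferentiableAt (𝓡 4) 𝓘(ℝ, ℝ) f x)
    (hg : MDifferentiableAt (𝓡 4) 𝓘(ℝ, ℝ) g x) :
    dirD e a (fun y => f y - g y) x = dirD e a f x - dirD e a g x := by
  simp only [dirD_eq_mvfderiv]
  change mvfderiv (𝓡 4) (f - g) x (e a x) = _
  rw [mvfderiv_sub hf hg]; rfl

lemma dirD_mul (hf : MDifferentiableAt (𝓡 4) 𝓘(ℝ, ℝ) f x)
    (hg : MDifferentiableAt (𝓡 4) 𝓘(ℝ, ℝ) g x) :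
    dirD e a (fun y => f y * g y) x = dirD e a f x * g x + f x * dirD e a g x := by
  simp only [dirD_eq_mvfderiv]
  change mvfderiv (𝓡 4) (f * g) x (e a x) = _
  rw [mvfderiv_mul hf hg]
  simp
  ring

lemma dirD_const_mul (c : ℝ) (hf : MDifferentiableAt (𝓡 4) 𝓘(ℝ, ℝ) f x) :
    dirD e a (fun y => c * f y) x = c * dirD e a f x := by
  rw [dirD_mul e a mdifferentiableAt_const hf]
  simp

lemma dirD_sum {ι : Type} (s : Finset ι) {F : ι → M → ℝ}
    (hF : ∀ i ∈ s, MDifferentiableAt (𝓡 4) 𝓘(ℝ, ℝ) (F i) x) :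
    dirD e a (fun y => ∑ i ∈ s, F i y) x = ∑ i ∈ s, dirD e a (F i) x := by
  classical
  induction s using Finset.induction_on with
  | empty => simp
  | insert i s hi ih =>
    simp only [Finset.sum_insert hi]
    rw [dirD_add, ih fun j hj => hF j (Finset.mem_insert_of_mem hj)]
    · exact hF i (Finset.mem_insert_self i s)
    · have := MDifferentiableAt.sum fun j hj => hF j (Finset.mem_insert_of_mem hj)
      rwa [show (∑ j ∈ s, F j) = fun y => ∑ j ∈ s, F j y from funext fun y => by simp] at this

lemma mdifferentiableAt_of_contMDiffOn {U : Set M} (hU : IsOpen U) (hx : x ∈ U)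
    (hf : ContMDiffOn (𝓡 4) 𝓘(ℝ, ℝ) ∞ f U) : MDifferentiableAt (𝓡 4) 𝓘(ℝ, ℝ) f x :=
  (hf.contMDiffAt (hU.mem_nhds hx)).mdifferentiableAt (by simp)

variable [IsManifold (𝓡 4) ∞ M] {U : Set M}

/-- The derivative is the fibre component of the tangent map of `f` composed with the section `e a`.
-/
lemma contMDiffOn_dirD (hU : IsOpen U)
    (he : ContMDiffOn (𝓡 4) (𝓡 4).tangent ∞ (fun x => (⟨x, e a x⟩ : TangentBundle (𝓡 4) M)) U)
    (hf : ContMDiffOn (𝓡 4) 𝓘(ℝ, ℝ) ∞ f U) :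
    ContMDiffOn (𝓡 4) 𝓘(ℝ, ℝ) ∞ (dirD e a f) U := by
  have h1 := hf.contMDiffOn_tangentMapWithin (m := ∞) (by simp) hU.uniqueMDiffOn
  have h2 := h1.comp he (fun x hx => hx)
  have h3 : ContMDiffOn (𝓡 4) 𝓘(ℝ, ℝ) ∞ (fun x => (tangentMapWithin (𝓡 4) 𝓘(ℝ, ℝ) f U
      ⟨x, e a x⟩).2) U := by
    intro x hx
    have := h2 x hx
    rw [Bundle.contMDiffWithinAt_totalSpace] at this
    simpa using! this.2
  refine h3.congr fun x hx => ?_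
  simp [tangentMapWithin, dirD, mfderivWithin_of_isOpen hU hx]
  rfl

end Calculus


/-! ### Lie brackets of the frame and the Jacobi identity. -/

section Tetrad

variable {M : Type*} [TopologicalSpace M] [ChartedSpace (EuclideanSpace ℝ (Fin 4)) M]
  [IsManifold (𝓡 4) ∞ M] {U : Set M} {x : M}

lemma isManifold_minSmoothness_three : IsManifold (𝓡 4) (minSmoothness ℝ 3) M :=
  IsManifold.of_le (n := ∞) (by simp; exact ENat.LEInfty.out)

/-- The Lie bracket of vector fields acts on functions as the commutator of derivations. -/
lemma dirD_comm_eq_mlieBracket (hU : IsOpen U) (e : Fin 4 → ∀ x : M, TangentSpace (𝓡 4) x)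
    (he : ∀ a, ContMDiffOn (𝓡 4) (𝓡 4).tangent ∞
      (fun x => (⟨x, e a x⟩ : TangentBundle (𝓡 4) M)) U)
    {f : M → ℝ} (hf : ContMDiffOn (𝓡 4) 𝓘(ℝ, ℝ) ∞ f U) (hx : x ∈ U) (a b c : Fin 4)
    (hc : e c x ≠ 0) :
    dirD e a (dirD e b f) x - dirD e b (dirD e a f) x
      = mvfderiv (𝓡 4) f x (mlieBracket (𝓡 4) (e a) (e b) x) := by
  have := isManifold_minSmoothness_three (M := M)
  have : IsManifold (𝓡 4) (∞ + 1) M := by simpa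
  have hsm (a : Fin 4) {y : M} (hy : y ∈ U) := (he a).contMDiffAt (hU.mem_nhds hy)
  have hd (a : Fin 4) {y : M} (hy : y ∈ U) := (hsm a hy).mdifferentiableAt (by simp)
  have hfs {y : M} (hy : y ∈ U) := hf.contMDiffAt (hU.mem_nhds hy)
  have hfd {y : M} (hy : y ∈ U) := (hfs hy).mdifferentiableAt (by simp)
  have hDf (a : Fin 4) {y : M} (hy : y ∈ U) :=
    ((contMDiffOn_dirD e a hU (he a) hf).contMDiffAt (hU.mem_nhds hy)).mdifferentiableAt
      (by simp)
  have hbr (a b : Fin 4) {y : M} (hy : y ∈ U) :=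
    ((hsm a hy).mlieBracket_vectorField (n := ⊤) (m := ⊤) (hsm b hy) (by simp)).mdifferentiableAt
      (by simp)
  have hsmul := (hfs hx).smul_section (hsm c hx)
  have h2 : minSmoothness ℝ 2 ≤ ∞ := by simp; exact ENat.LEInfty.out
  -- The Leibniz identity for brackets is applied to the field `f • e c`: iterated derivatives of
  -- `f` then appear as coefficients of `e c`.
  have key := leibniz_identity_mlieBracket_apply (I := 𝓡 4) (U := e a) (V := e b) (W := f • e c)
    ((hsm a hx).of_le h2) ((hsm b hx).of_le h2) (hsmul.of_le h2)
  have expand (a : Fin 4) : mlieBracket (𝓡 4) (e a) (f • e c)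
      =ᶠ[nhds x] dirD e a f • e c + f • mlieBracket (𝓡 4) (e a) (e c) := by
    filter_upwards [hU.mem_nhds hx] with y hy
    rw [mlieBracket_smul_right (hfd hy) (hd c hy)]
    rfl
  have lie0 := leibniz_identity_mlieBracket_apply (I := 𝓡 4) (U := e a) (V := e b) (W := e c)
    ((hsm a hx).of_le h2) ((hsm b hx).of_le h2) ((hsm c hx).of_le h2)
  have second (a b : Fin 4) : mlieBracket (𝓡 4) (e a) (mlieBracket (𝓡 4) (e b) (f • e c)) x
      = dirD e a (dirD e b f) x • e c x + dirD e b f x • mlieBracket (𝓡 4) (e a) (e c) x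
        + (dirD e a f x • mlieBracket (𝓡 4) (e b) (e c) x
          + f x • mlieBracket (𝓡 4) (e a) (mlieBracket (𝓡 4) (e b) (e c)) x) := by
    rw [Filter.EventuallyEq.rfl.mlieBracket_vectorField_eq (expand b), mlieBracket_add_right,
      mlieBracket_smul_right (hDf b hx) (hd c hx), mlieBracket_smul_right (hfd hx) (hbr b c hx)]
    · rfl
    · exact (hDf b hx).smul_section (hd c hx)
    · exact (hfd hx).smul_section (hbr b c hx)
  -- The mixed first-order terms are symmetric in `a`, `b`, and the terms without derivatives of `f`
  -- cancel by `lie0`. Only a multiple of `e c x ≠ 0` is left.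
  rw [second a b, second b a, mlieBracket_smul_right (hfd hx) (hd c hx), lie0] at key
  have : (dirD e a (dirD e b f) x - dirD e b (dirD e a f) x
      - mvfderiv (𝓡 4) f x (mlieBracket (𝓡 4) (e a) (e b) x)) • e c x = 0 := by
    rw [← sub_eq_zero.2 key]
    module
  have := (smul_eq_zero.1 this).resolve_right hc
  exact sub_eq_zero.1 this

namespace IsTetrad

variable {g : ∀ x : M, LinearMap.BilinForm ℝ (TangentSpace (𝓡 4) x)}
  {e : Fin 4 → ∀ x : M, TangentSpace (𝓡 4) x} {γ : M → Fin 4 → Fin 4 → Fin 4 → ℝ}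

lemma eq_zero_of_sum_smul_eq_zero (he : IsTetrad U g e γ) (hx : x ∈ U) {t : Fin 4 → ℝ}
    (ht : ∑ c, t c • e c x = 0) (d : Fin 4) : t d = 0 := by
  have h := congrArg (fun v => g x v (e d x)) ht
  simp only [map_sum, map_smul, LinearMap.sum_apply, LinearMap.smul_apply, map_zero,
    LinearMap.zero_apply, he.orthonormal x hx, smul_eq_mul, eta, mul_ite, mul_zero,
    Finset.sum_ite_eq', Finset.mem_univ, if_true] at h
  split_ifs at h <;> linarith

lemma ne_zero (he : IsTetrad U g e γ) (hx : x ∈ U) (c : Fin 4) : e c x ≠ 0 := by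
  intro h
  have := he.orthonormal x hx c c
  rw [h] at this
  simp only [map_zero, eta, if_true] at this
  split_ifs at this <;> linarith

lemma comm_antisymm (he : IsTetrad U g e γ) (hx : x ∈ U) (c a b : Fin 4) :
    γ x c a b = - γ x c b a := by
  have h : ∑ c, (γ x c a b + γ x c b a) • e c x = 0 := by
    simp only [add_smul, Finset.sum_add_distrib, ← he.comm x hx]
    rw [mlieBracket_swap_apply]
    simp
  linarith [he.eq_zero_of_sum_smul_eq_zero hx h c]

lemma dirD_comm (he : IsTetrad U g e γ) (hU : IsOpen U) (hx : x ∈ U) {f : M → ℝ}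
    (hf : ContMDiffOn (𝓡 4) 𝓘(ℝ, ℝ) ∞ f U) (a b : Fin 4) :
    dirD e a (dirD e b f) x - dirD e b (dirD e a f) x = ∑ c, γ x c a b * dirD e c f x := by
  rw [dirD_comm_eq_mlieBracket hU e he.smooth hf hx a b 0 (he.ne_zero hx 0), he.comm x hx]
  simp [map_sum, dirD_eq_mvfderiv]

lemma mlieBracket_sum_smul (he : IsTetrad U g e γ) (hU : IsOpen U) (hx : x ∈ U)
    {t : Fin 4 → M → ℝ} (ht : ∀ c, ContMDiffOn (𝓡 4) 𝓘(ℝ, ℝ) ∞ (t c) U) (a : Fin 4) :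
    mlieBracket (𝓡 4) (e a) (fun y => ∑ c, t c y • e c y) x
      = ∑ c, (dirD e a (t c) x + ∑ f, γ x c a f * t f x) • e c x := by
  have := isManifold_minSmoothness_three (M := M)
  have hd (a : Fin 4) := ((he.smooth a).contMDiffAt (hU.mem_nhds hx)).mdifferentiableAt
    (n := ∞) (by simp)
  have htd (c : Fin 4) := ((ht c).contMDiffAt (hU.mem_nhds hx)).mdifferentiableAt
    (n := ∞) (by simp)
  have hs (c : Fin 4) := (htd c).smul_section (hd c)
  have h (c : Fin 4) : mlieBracket (𝓡 4) (e a) (t c • e c) x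
      = dirD e a (t c) x • e c x + t c x • ∑ f, γ x f a c • e f x := by
    rw [mlieBracket_smul_right (htd c) (hd c), he.comm x hx]
    rfl
  have h4 : (fun y => ∑ c, t c y • e c y)
      = t 0 • e 0 + t 1 • e 1 + t 2 • e 2 + t 3 • e 3 := by
    funext y
    simp [Fin.sum_univ_four]
  have h1 := mdifferentiableAt_add_section (hs 0) (hs 1)
  have h2 := mdifferentiableAt_add_section h1 (hs 2)
  rw [h4, mlieBracket_add_right h2 (hs 3), mlieBracket_add_right h1 (hs 2),
    mlieBracket_add_right (hs 0) (hs 1), h, h, h, h]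
  simp only [Fin.sum_univ_four]
  module

/-- These are the frame components of the Jacobi identity for the fields `e a`, `e b`, `e c`. -/
lemma jacobi (he : IsTetrad U g e γ) (hU : IsOpen U) (hx : x ∈ U) (d a b c : Fin 4) :
    (dirD e a (fun y => γ y d b c) x - ∑ f, γ x d f a * γ x f b c)
      + (dirD e b (fun y => γ y d c a) x - ∑ f, γ x d f b * γ x f c a)
      + (dirD e c (fun y => γ y d a b) x - ∑ f, γ x d f c * γ x f a b) = 0 := by
  have := isManifold_minSmoothness_three (M := M)
  have h2 : minSmoothness ℝ 2 ≤ ∞ := by simp; exact ENat.LEInfty.out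
  have hsm (a : Fin 4) := ((he.smooth a).contMDiffAt (hU.mem_nhds hx)).of_le h2
  have hbr (a b c : Fin 4) : mlieBracket (𝓡 4) (e a) (mlieBracket (𝓡 4) (e b) (e c)) x
      = ∑ d, (dirD e a (fun y => γ y d b c) x - ∑ f, γ x d f a * γ x f b c) • e d x := by
    have h : mlieBracket (𝓡 4) (e b) (e c) =ᶠ[nhds x]
        (fun y => ∑ d, γ y d b c • e d y : ∀ y, TangentSpace (𝓡 4) y) := by
      filter_upwards [hU.mem_nhds hx] with y hy using he.comm y hy b c
    refine (Filter.EventuallyEq.rfl.mlieBracket_vectorField_eq h).trans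
      ((he.mlieBracket_sum_smul hU hx (t := fun d y => γ y d b c)
        (fun d => he.smooth_comm d b c) a).trans ?_)
    refine Finset.sum_congr rfl fun d _ => ?_
    congr 1
    rw [sub_eq_add_neg, ← Finset.sum_neg_distrib]
    congr 1
    refine Finset.sum_congr rfl fun f _ => ?_
    rw [he.comm_antisymm hx d a f]
    ring
  have key := leibniz_identity_mlieBracket_apply (I := 𝓡 4) (hsm a) (hsm b) (hsm c)
  have hca : mlieBracket (𝓡 4) (e b) (mlieBracket (𝓡 4) (e a) (e c)) x
      = - mlieBracket (𝓡 4) (e b) (mlieBracket (𝓡 4) (e c) (e a)) x := by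
    rw [hbr, hbr, ← Finset.sum_neg_distrib]
    refine Finset.sum_congr rfl fun d _ => ?_
    have hD : dirD e b (fun y => γ y d a c) x = - dirD e b (fun y => γ y d c a) x := by
      have hdiff := ((he.smooth_comm d c a).contMDiffAt (hU.mem_nhds hx)).mdifferentiableAt
        (by simp)
      rw [← neg_one_mul, ← dirD_const_mul e b (-1) hdiff]
      apply dirD_congr
      filter_upwards [hU.mem_nhds hx] with y hy
      rw [he.comm_antisymm hy d a c]
      ring
    rw [hD, ← neg_smul]
    congr 1
    simp only [he.comm_antisymm hx _ a c, mul_neg, Finset.sum_neg_distrib]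
    ring
  rw [hca, mlieBracket_swap_apply (V := mlieBracket (𝓡 4) (e a) (e b)), hbr, hbr, hbr] at key
  refine he.eq_zero_of_sum_smul_eq_zero hx (t := fun d =>
    (dirD e a (fun y => γ y d b c) x - ∑ f, γ x d f a * γ x f b c)
      + (dirD e b (fun y => γ y d c a) x - ∑ f, γ x d f b * γ x f c a)
      + (dirD e c (fun y => γ y d a b) x - ∑ f, γ x d f c * γ x f a b)) ?_ d
  simp only [add_smul, Finset.sum_add_distrib]
  rw [key]
  abel

end IsTetrad

end Tetrad

end JRB

/-! ### The Levi-Civita connection and the symmetries of its curvature. -/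

namespace JRB

lemma sum_eta_mul (a : Fin 4) (t : Fin 4 → ℝ) : ∑ b, eta a b * t b = eta a a * t a := by
  simp [eta]

lemma eta_mul_self (a : Fin 4) : eta a a * eta a a = 1 := by
  simp only [eta, if_true]
  split_ifs <;> norm_num

lemma lower_eq (R : Fin 4 → Fin 4 → Fin 4 → Fin 4 → ℝ) (a b c d : Fin 4) :
    lower R a b c d = eta a a * R a b c d := sum_eta_mul a fun e => R e b c d

section Algebra

variable {A : Fin 4 → Fin 4 → Fin 4 → ℝ} {G : Fin 4 → Fin 4 → Fin 4 → ℝ}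

/-- The algebraic core of the second Bianchi identity.  `A`, `dA`, `ddA` stand for the connection
coefficients and their first and second derivatives, `G` and `dG` for the commutation coefficients
and their derivatives. -/
lemma second_bianchi_algebra {dA dG : Fin 4 → Fin 4 → Fin 4 → Fin 4 → ℝ}
    {ddA : Fin 4 → Fin 4 → Fin 4 → Fin 4 → Fin 4 → ℝ}
    (hG : ∀ c a b, G c a b = - G c b a)
    (hcomm : ∀ k c a b d, ddA k c a b d - ddA c k a b d = ∑ f, G f k c * dA f a b d)
    (hjac : ∀ d a b c, (dG a d b c - ∑ f, G d f a * G f b c)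
      + (dG b d c a - ∑ f, G d f b * G f c a) + (dG c d a b - ∑ f, G d f c * G f a b) = 0)
    {R : Fin 4 → Fin 4 → Fin 4 → Fin 4 → ℝ}
    (hR : ∀ a b c d, R a b c d = dA c a b d - dA d a b c
      + ∑ f, (A f b d * A a f c - A f b c * A a f d - G f c d * A a b f))
    {dR : Fin 4 → Fin 4 → Fin 4 → Fin 4 → Fin 4 → ℝ}
    (hdR : ∀ k a b c d, dR k a b c d = ddA k c a b d - ddA k d a b c
      + ∑ f, (dA k f b d * A a f c + A f b d * dA k a f c
        - (dA k f b c * A a f d + A f b c * dA k a f d)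
        - (dG k f c d * A a b f + G f c d * dA k a b f)))
    (a b c d k : Fin 4) :
    (dR k a b c d + ∑ f, (A a f k * R f b c d - A f b k * R a f c d + G f c k * R a b f d))
    + (dR c a b d k + ∑ f, (A a f c * R f b d k - A f b c * R a f d k + G f d c * R a b f k))
    + (dR d a b k c + ∑ f, (A a f d * R f b k c - A f b d * R a f k c + G f k d * R a b f c))
      = 0 := by
  have c1 := hcomm k c a b d
  have c2 := hcomm c d a b k
  have c3 := hcomm d k a b c
  have j0 := hjac 0 k c d
  have j1 := hjac 1 k c d
  have j2 := hjac 2 k c d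
  have j3 := hjac 3 k c d
  have g1 : ∀ f, G f c k = - G f k c := fun f => hG f c k
  have g2 : ∀ f, G f d c = - G f c d := fun f => hG f d c
  have g3 : ∀ f, G f k d = - G f d k := fun f => hG f k d
  simp only [hdR, hR, g1, g2, g3]
  clear hR hdR hjac hcomm hG g1 g2 g3
  simp only [Fin.sum_univ_four] at *
  -- Second derivatives cancel through the commutators, derivatives of `G` through the Jacobi
  -- identity contracted with `A a b ·`; the rest cancels identically.
  linear_combination c1 + c2 + c3 - A a b 0 * j0 - A a b 1 * j1 - A a b 2 * j2 - A a b 3 * j3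

end Algebra

lemma conn_eq {M : Type*} (γ : M → Fin 4 → Fin 4 → Fin 4 → ℝ) (x : M) (c a b : Fin 4) :
    conn γ x c a b = eta c c * ((1 / 2) * (eta b b * γ x b c a + eta a a * γ x a c b
      - eta c c * γ x c a b)) := by
  simp only [conn, connLow, sum_eta_mul, Finset.sum_add_distrib, Finset.sum_sub_distrib]

namespace IsTetrad

variable {M : Type*} [TopologicalSpace M] [ChartedSpace (EuclideanSpace ℝ (Fin 4)) M]
  [IsManifold (𝓡 4) ∞ M] {U : Set M} {x : M}
  {g : ∀ x : M, LinearMap.BilinForm ℝ (TangentSpace (𝓡 4) x)}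
  {e : Fin 4 → ∀ x : M, TangentSpace (𝓡 4) x} {γ : M → Fin 4 → Fin 4 → Fin 4 → ℝ}

lemma contMDiffOn_conn (he : IsTetrad U g e γ) (c a b : Fin 4) :
    ContMDiffOn (𝓡 4) 𝓘(ℝ, ℝ) ∞ (fun x => conn γ x c a b) U := by
  simp only [conn_eq]
  have := he.smooth_comm
  exact contMDiffOn_const.mul (contMDiffOn_const.mul (((contMDiffOn_const.mul (this b c a)).add
    (contMDiffOn_const.mul (this a c b))).sub (contMDiffOn_const.mul (this c a b))))

/-- The connection has no torsion. -/
lemma conn_sub_conn (he : IsTetrad U g e γ) (hx : x ∈ U) (c a b : Fin 4) :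
    conn γ x c a b - conn γ x c b a = - γ x c a b := by
  rw [conn_eq, conn_eq]
  have h := he.comm_antisymm hx
  rw [h c b a]
  linear_combination (- γ x c a b) * eta_mul_self c

/-- The connection preserves the metric. -/
lemma conn_metric (he : IsTetrad U g e γ) (hx : x ∈ U) (c a b : Fin 4) :
    conn γ x c a b = - (eta c c * eta a a) * conn γ x a c b := by
  rw [conn_eq, conn_eq]
  have h := he.comm_antisymm hx
  rw [h b a c, h c a b]
  linear_combination (1 / 2 * eta c c * (eta b b * γ x b c a + eta c c * γ x c b a
    + eta a a * γ x a c b)) * (- eta_mul_self a)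

lemma contMDiffOn_dirD (he : IsTetrad U g e γ) (hU : IsOpen U) {f : M → ℝ}
    (hf : ContMDiffOn (𝓡 4) 𝓘(ℝ, ℝ) ∞ f U) (a : Fin 4) :
    ContMDiffOn (𝓡 4) 𝓘(ℝ, ℝ) ∞ (dirD e a f) U :=
  JRB.contMDiffOn_dirD e a hU (he.smooth a) hf

lemma contMDiffOn_curv (he : IsTetrad U g e γ) (hU : IsOpen U) (a b c d : Fin 4) :
    ContMDiffOn (𝓡 4) 𝓘(ℝ, ℝ) ∞ (fun x => curv e γ x a b c d) U := by
  have hc := he.contMDiffOn_conn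
  refine ((he.contMDiffOn_dirD hU (hc a b d) c).sub (he.contMDiffOn_dirD hU (hc a b c) d)).add
    (contMDiffOn_finsetSum fun f _ => ?_)
  exact (((hc f b d).mul (hc a f c)).sub ((hc f b c).mul (hc a f d))).sub
    ((he.smooth_comm f c d).mul (hc a b f))

lemma dirD_curv (he : IsTetrad U g e γ) (hU : IsOpen U) (hx : x ∈ U) (k a b c d : Fin 4) :
    dirD e k (fun y => curv e γ y a b c d) x
      = dirD e k (dirD e c fun y => conn γ y a b d) x
        - dirD e k (dirD e d fun y => conn γ y a b c) x
        + ∑ f, (dirD e k (fun y => conn γ y f b d) x * conn γ x a f c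
            + conn γ x f b d * dirD e k (fun y => conn γ y a f c) x
          - (dirD e k (fun y => conn γ y f b c) x * conn γ x a f d
            + conn γ x f b c * dirD e k (fun y => conn γ y a f d) x)
          - (dirD e k (fun y => γ y f c d) x * conn γ x a b f
            + γ x f c d * dirD e k (fun y => conn γ y a b f) x)) := by
  have hd {f : M → ℝ} (hf : ContMDiffOn (𝓡 4) 𝓘(ℝ, ℝ) ∞ f U) :=
    mdifferentiableAt_of_contMDiffOn hU hx hf
  have hc := he.contMDiffOn_conn
  have hγ := he.smooth_comm
  have hdc (a b d c : Fin 4) := he.contMDiffOn_dirD hU (hc a b d) c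
  have h1 (f : Fin 4) := (hc f b d).mul (hc a f c)
  have h2 (f : Fin 4) := (hc f b c).mul (hc a f d)
  have h3 (f : Fin 4) := (hγ f c d).mul (hc a b f)
  simp only [curv]
  rw [dirD_add, dirD_sub, dirD_sum]
  · congr 1
    refine Finset.sum_congr rfl fun f _ => ?_
    rw [dirD_sub, dirD_sub, dirD_mul, dirD_mul, dirD_mul]
    · exact hd (hγ f c d)
    · exact hd (hc a b f)
    · exact hd (hc f b c)
    · exact hd (hc a f d)
    · exact hd (hc f b d)
    · exact hd (hc a f c)
    · exact hd (h1 f)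
    · exact hd (h2 f)
    · exact hd ((h1 f).sub (h2 f))
    · exact hd (h3 f)
  · exact fun f _ => hd (((h1 f).sub (h2 f)).sub (h3 f))
  · exact hd (hdc a b d c)
  · exact hd (hdc a b c d)
  · exact hd ((hdc a b d c).sub (hdc a b c d))
  · exact hd (contMDiffOn_finsetSum fun f _ => ((h1 f).sub (h2 f)).sub (h3 f))

lemma curv_antisymm_right (he : IsTetrad U g e γ) (hx : x ∈ U) (a b c d : Fin 4) :
    curv e γ x a b c d = - curv e γ x a b d c := by
  simp only [curv, he.comm_antisymm hx _ c d, Fin.sum_univ_four]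
  ring

lemma bianchi_second_curv (he : IsTetrad U g e γ) (hU : IsOpen U) (hx : x ∈ U)
    (a b c d k : Fin 4) : bianchiRes e γ (curv e γ) a b c d k x = 0 := by
  have key (c d k : Fin 4) : covD13 e γ (curv e γ) x a b c d k
      + covD13 e γ (curv e γ) x a b d k c + covD13 e γ (curv e γ) x a b k c d = 0 := by
    have h := second_bianchi_algebra (A := conn γ x) (G := γ x) (R := curv e γ x)
      (dA := fun k a b c => dirD e k (fun y => conn γ y a b c) x)
      (dG := fun k a b c => dirD e k (fun y => γ y a b c) x)
      (ddA := fun k l a b c => dirD e k (dirD e l fun y => conn γ y a b c) x)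
      (dR := fun k a b c d => dirD e k (fun y => curv e γ y a b c d) x)
      (he.comm_antisymm hx)
      (fun k c a b d => he.dirD_comm hU hx (he.contMDiffOn_conn a b d) k c)
      (he.jacobi hU hx) (fun a b c d => rfl) (fun k a b c d => he.dirD_curv hU hx k a b c d)
      a b c d k
    have r := he.curv_antisymm_right (e := e) hx a b
    have t := he.conn_sub_conn hx
    -- In the cyclic sum the connection terms on the form indices pair up into torsion combinations,
    -- which are commutation coefficients. This is the form used in `second_bianchi_algebra`.
    have t1 (f : Fin 4) : γ x f c k = conn γ x f k c - conn γ x f c k := by linarith [t f c k]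
    have t2 (f : Fin 4) : γ x f d c = conn γ x f c d - conn γ x f d c := by linarith [t f d c]
    have t3 (f : Fin 4) : γ x f k d = conn γ x f d k - conn γ x f k d := by linarith [t f k d]
    have r1 (f : Fin 4) := r c f
    have r2 (f : Fin 4) := r d f
    have r3 (f : Fin 4) := r k f
    simp only [covD13, r1, r2, r3]
    simp only [t1, t2, t3] at h
    rw [← h]
    simp only [Fin.sum_univ_four]
    ring
  -- `alt3` is one sixth of the difference of the cyclic sums in the two orientations.
  have h1 := key c d k
  have h2 := key d c k
  simp only [bianchiRes, alt3]
  linarith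

/-- The Ricci identity for `u`. -/
lemma ricci_identity (he : IsTetrad U g e γ) (hx : x ∈ U) (a c d : Fin 4) :
    covD11 e γ (gradU e γ) x a c d - covD11 e γ (gradU e γ) x a d c = curv e γ x a 0 d c := by
  -- The components of `u` are constant, so its gradient is a block of connection coefficients.
  have hg : gradU e γ = fun y a b => conn γ y a 0 b := by
    funext y a b
    simp [gradU, covD1, uUp]
  have t (f : Fin 4) : γ x f d c = conn γ x f c d - conn γ x f d c := by
    linarith [he.conn_sub_conn hx f d c]
  simp only [hg, covD11, curv, t, Fin.sum_univ_four]
  ring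

lemma curv_antisymm_left (he : IsTetrad U g e γ) (hU : IsOpen U) (hx : x ∈ U)
    (a b c d : Fin 4) : lower (curv e γ x) a b c d = - lower (curv e γ x) b a c d := by
  -- Metric compatibility holds on all of `U`, so it may be differentiated.
  have hD (a b c d : Fin 4) : dirD e c (fun y => conn γ y a b d) x
      = - (eta a a * eta b b) * dirD e c (fun y => conn γ y b a d) x := by
    rw [← dirD_const_mul e c _ (mdifferentiableAt_of_contMDiffOn hU hx
      (he.contMDiffOn_conn b a d))]
    apply dirD_congr
    filter_upwards [hU.mem_nhds hx] with y hy using he.conn_metric hy a b d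
  have m := he.conn_metric hx
  have s := eta_mul_self
  rw [lower_eq, lower_eq, curv, curv, hD a b c d, hD a b d c, mul_add, mul_add, neg_add,
    Finset.mul_sum, Finset.mul_sum, ← Finset.sum_neg_distrib]
  congr 1
  · linear_combination (- eta b b * (dirD e c (fun y => conn γ y b a d) x
      - dirD e d (fun y => conn γ y b a c) x)) * s a
  · refine Finset.sum_congr rfl fun f _ => ?_
    rw [m a b f, m f b d, m a f c, m f b c, m a f d]
    linear_combination (- γ x f c d * - eta b b * conn γ x b a f) * s a
      + (eta b b * (conn γ x b f d * conn γ x f a c - conn γ x b f c * conn γ x f a d))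
        * (s f + eta f f * eta f f * s a)

lemma curv_bianchi_first (he : IsTetrad U g e γ) (hU : IsOpen U) (hx : x ∈ U)
    (a b c d : Fin 4) :
    curv e γ x a b c d + curv e γ x a c d b + curv e γ x a d b c = 0 := by
  have hD (k b c : Fin 4) : dirD e k (fun y => γ y a b c) x
      = dirD e k (fun y => conn γ y a c b) x - dirD e k (fun y => conn γ y a b c) x := by
    have h (b c : Fin 4) := mdifferentiableAt_of_contMDiffOn hU hx (he.contMDiffOn_conn a b c)
    rw [← dirD_sub e k (h c b) (h b c)]
    apply dirD_congr
    filter_upwards [hU.mem_nhds hx] with y hy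
    linarith [he.conn_sub_conn hy a b c]
  have j := he.jacobi hU hx a b c d
  have t (f b c : Fin 4) : γ x f b c = conn γ x f c b - conn γ x f b c := by
    linarith [he.conn_sub_conn hx f b c]
  simp only [hD, t, Fin.sum_univ_four] at j
  simp only [curv, t, Fin.sum_univ_four]
  linear_combination j

lemma isCurvatureLike_curv (he : IsTetrad U g e γ) (hU : IsOpen U) :
    IsCurvatureLike U e γ (curv e γ) where
  smooth := he.contMDiffOn_curv hU
  antisymm_left x hx := he.curv_antisymm_left hU hx
  antisymm_right x hx a b c d := by
    rw [lower_eq, lower_eq, he.curv_antisymm_right hx]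
    ring
  symm_pair x hx a b c d := by
    have hl := he.curv_antisymm_left hU hx
    have hr (a b c d) : lower (curv e γ x) a b c d = - lower (curv e γ x) a b d c := by
      rw [lower_eq, lower_eq, he.curv_antisymm_right hx]
      ring
    have hb (a b c d) : lower (curv e γ x) a b c d + lower (curv e γ x) a c d b
        + lower (curv e γ x) a d b c = 0 := by
      rw [lower_eq, lower_eq, lower_eq, ← mul_add, ← mul_add, he.curv_bianchi_first hU hx,
        mul_zero]
    -- Pair symmetry follows from four instances of the first Bianchi identity and the two
    -- antisymmetries.
    linarith [hb a b c d, hb b c d a, hb c d a b, hb d a b c, hl a b c d, hl a b d c,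
      hl a c b d, hl a c d b, hl a d b c, hl a d c b, hl b c d a, hl b c a d, hl b d a c,
      hl b d c a, hl c d a b, hl c d b a, hr a b c d, hr a c b d, hr a d b c, hr b c a d,
      hr b d a c, hr c d a b, hr b a c d, hr c a b d, hr d a b c, hr c b a d, hr d b a c,
      hr d c a b]
  bianchi_first x hx a b c d := by
    have h1 := he.curv_bianchi_first hU hx a b c d
    have h2 := he.curv_bianchi_first hU hx a c b d
    simp only [alt3, lower_eq]
    linear_combination (1 / 6 * eta a a) * (h1 - h2)
  bianchi_second x hx := he.bianchi_second_curv hU hx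
  ricci x hx a c d := by
    rw [ricciRes, he.ricci_identity hx]
    simp [uUp]

end IsTetrad

end JRB

/-! ### Symmetric forms on bivectors and the components of the Weyl tensor. -/

namespace JRB

/-- The integer determinant in `leviCivita` as a Vandermonde product. -/
lemma twelve_mul_leviCivita (a b c d : Fin 4) :
    12 * leviCivita a b c d
      = - ((((b : ℤ) - a) * (c - a) * (d - a) * (c - b) * (d - b) * (d - c) : ℤ) : ℝ) := by
  -- For a permutation of `0, 1, 2, 3` the product of differences is its sign times `1·2·3·1·2·1 =
  -- 12`; with a repeated index both sides vanish.
  have h : ∀ a b c d : Fin 4, 12 * (Matrix.of fun i j : Fin 4 =>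
      if ![a, b, c, d] i = j then (1 : ℤ) else 0).det
      = ((b : ℤ) - a) * (c - a) * (d - a) * (c - b) * (d - b) * (d - c) := by
    intro a b c d
    simp only [Matrix.det_succ_row_zero, Fin.sum_univ_succ]
    revert a b c d
    decide
  rw [← h, leviCivita]
  push_cast
  ring

/-- A polynomial in the indices, so that components can be evaluated by arithmetic instead of
determinants. -/
lemma eps_eq (a b c : Fin 4) :
    eps a b c = ((b : ℝ) - a) * (c - a) * (c - b) * a * b * c / 12 := by
  have h := twelve_mul_leviCivita a b c 0
  have h' : eps a b c = leviCivita a b c 0 := by simp [eps, uUp]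
  rw [h']
  simp only [Fin.val_zero] at h
  push_cast at h
  linear_combination h / 12

lemma leviCivita_zero_second (a m n : Fin 4) : leviCivita a 0 m n = eps a m n := by
  have h := twelve_mul_leviCivita a 0 m n
  rw [eps_eq]
  simp only [Fin.val_zero] at h
  push_cast at h
  linear_combination h / 12

lemma eps_swap (a b c : Fin 4) : eps b a c = - eps a b c := by
  rw [eps_eq, eps_eq]
  ring

lemma eta_comm (a b : Fin 4) : eta a b = eta b a := by
  simp only [eta]
  split_ifs <;> simp_all

lemma hLow_comm (a b : Fin 4) : hLow a b = hLow b a := by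
  rw [hLow, hLow, eta_comm, mul_comm (uLow a)]

/-- The array `C_abcd` is a symmetric form on bivectors. -/
structure IsBivectorForm (C : Fin 4 → Fin 4 → Fin 4 → Fin 4 → ℝ) : Prop where
  antisymm_left : ∀ a b c d, C a b c d = - C b a c d
  antisymm_right : ∀ a b c d, C a b c d = - C a b d c
  symm_pair : ∀ a b c d, C a b c d = C c d a b

lemma IsBivectorForm.sub {C D : Fin 4 → Fin 4 → Fin 4 → Fin 4 → ℝ} (hC : IsBivectorForm C)
    (hD : IsBivectorForm D) : IsBivectorForm fun a b c d => C a b c d - D a b c d where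
  antisymm_left a b c d := by rw [hC.antisymm_left, hD.antisymm_left]; ring
  antisymm_right a b c d := by rw [hC.antisymm_right, hD.antisymm_right]; ring
  symm_pair a b c d := by rw [hC.symm_pair, hD.symm_pair]

lemma IsBivectorForm.add {C D : Fin 4 → Fin 4 → Fin 4 → Fin 4 → ℝ} (hC : IsBivectorForm C)
    (hD : IsBivectorForm D) : IsBivectorForm fun a b c d => C a b c d + D a b c d where
  antisymm_left a b c d := by rw [hC.antisymm_left, hD.antisymm_left]; ring
  antisymm_right a b c d := by rw [hC.antisymm_right, hD.antisymm_right]; ring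
  symm_pair a b c d := by rw [hC.symm_pair, hD.symm_pair]

lemma eq_zero_of_antisymm {t : Fin 4 → Fin 4 → ℝ} (ht : ∀ a b, t a b = - t b a)
    (h01 : t 0 1 = 0) (h02 : t 0 2 = 0) (h03 : t 0 3 = 0) (h12 : t 1 2 = 0) (h13 : t 1 3 = 0)
    (h23 : t 2 3 = 0) (a b : Fin 4) : t a b = 0 := by
  have hd (a : Fin 4) : t a a = 0 := by linarith [ht a a]
  fin_cases a <;> fin_cases b <;>
    first | exact hd _ | assumption | (rw [ht]; simpa using by assumption)

/-- A symmetric form on bivectors is determined by its 21 independent components. -/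
lemma IsBivectorForm.eq_zero {F : Fin 4 → Fin 4 → Fin 4 → Fin 4 → ℝ} (hF : IsBivectorForm F)
    (h0101 : F 0 1 0 1 = 0)
    (h0102 : F 0 1 0 2 = 0)
    (h0103 : F 0 1 0 3 = 0)
    (h0112 : F 0 1 1 2 = 0)
    (h0113 : F 0 1 1 3 = 0)
    (h0123 : F 0 1 2 3 = 0)
    (h0202 : F 0 2 0 2 = 0)
    (h0203 : F 0 2 0 3 = 0)
    (h0212 : F 0 2 1 2 = 0)
    (h0213 : F 0 2 1 3 = 0)
    (h0223 : F 0 2 2 3 = 0)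
    (h0303 : F 0 3 0 3 = 0)
    (h0312 : F 0 3 1 2 = 0)
    (h0313 : F 0 3 1 3 = 0)
    (h0323 : F 0 3 2 3 = 0)
    (h1212 : F 1 2 1 2 = 0)
    (h1213 : F 1 2 1 3 = 0)
    (h1223 : F 1 2 2 3 = 0)
    (h1313 : F 1 3 1 3 = 0)
    (h1323 : F 1 3 2 3 = 0)
    (h2323 : F 2 3 2 3 = 0)
    (a b c d : Fin 4) : F a b c d = 0 := by
  have hp (a b : Fin 4) (h01 : F a b 0 1 = 0) (h02 : F a b 0 2 = 0) (h03 : F a b 0 3 = 0)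
      (h12 : F a b 1 2 = 0) (h13 : F a b 1 3 = 0) (h23 : F a b 2 3 = 0) (c d : Fin 4) :
      F a b c d = 0 :=
    eq_zero_of_antisymm (hF.antisymm_right a b) h01 h02 h03 h12 h13 h23 c d
  have hs {a b c d : Fin 4} (h : F a b c d = 0) : F c d a b = 0 := by
    rw [hF.symm_pair, h]
  refine eq_zero_of_antisymm (t := fun a b => F a b c d)
    (fun a b => hF.antisymm_left a b c d) ?_ ?_ ?_ ?_ ?_ ?_ a b <;>
    apply hp <;> first | assumption | (apply hs; assumption)

variable {E H S : Fin 4 → Fin 4 → ℝ}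

lemma isBivectorForm_ricciPart (hS : ∀ a b, S a b = S b a) : IsBivectorForm (ricciPart S) where
  antisymm_left a b c d := by
    rw [ricciPart, ricciPart, eta_comm d b, eta_comm c b, eta_comm d a, eta_comm c a]
    ring
  antisymm_right a b c d := by
    rw [ricciPart, ricciPart]
    ring
  symm_pair a b c d := by
    rw [ricciPart, ricciPart, eta_comm c a, eta_comm c b, eta_comm d b, eta_comm d a,
      hS b d, hS a d, hS a c, hS b c, eta_comm b c]
    ring

lemma isBivectorForm_weylOf (hE : ∀ a b, E a b = E b a) :
    IsBivectorForm (weylOf E H) where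
  antisymm_left a b c d := by
    simp only [weylOf, eps_swap a b, Fin.sum_univ_four]
    ring
  antisymm_right a b c d := by
    simp only [weylOf, eps_swap c d, Fin.sum_univ_four]
    ring
  symm_pair a b c d := by
    rw [weylOf, weylOf, hLow_comm c a, hLow_comm d a, hLow_comm c b, hLow_comm d b, hE d b,
      hE c b, hE d a, hE c a]
    ring

lemma trace_ricciPart (hS : ∀ a b, S a b = S b a) (b d : Fin 4) :
    ∑ c, eta c c * ricciPart S c b c d = S b d := by
  rw [hS b d]
  simp only [ricciPart, trace2, Fin.sum_univ_four]
  fin_cases b <;> fin_cases d <;> simp [eta] <;> ring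

/-- Rewriting the components of a symmetric form on bivectors to the independent ones. -/
lemma IsBivectorForm.ordered {C : Fin 4 → Fin 4 → Fin 4 → Fin 4 → ℝ} (hC : IsBivectorForm C) :
    (∀ a c d, C a a c d = 0) ∧ (∀ a b c, C a b c c = 0)
    ∧ (∀ c d, C 1 0 c d = -C 0 1 c d)
    ∧ (∀ c d, C 2 0 c d = -C 0 2 c d)
    ∧ (∀ c d, C 3 0 c d = -C 0 3 c d)
    ∧ (∀ c d, C 2 1 c d = -C 1 2 c d)
    ∧ (∀ c d, C 3 1 c d = -C 1 3 c d)
    ∧ (∀ c d, C 3 2 c d = -C 2 3 c d)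
    ∧ (∀ a b, C a b 1 0 = -C a b 0 1)
    ∧ (∀ a b, C a b 2 0 = -C a b 0 2)
    ∧ (∀ a b, C a b 3 0 = -C a b 0 3)
    ∧ (∀ a b, C a b 2 1 = -C a b 1 2)
    ∧ (∀ a b, C a b 3 1 = -C a b 1 3)
    ∧ (∀ a b, C a b 3 2 = -C a b 2 3)
    ∧ C 0 2 0 1 = C 0 1 0 2
    ∧ C 0 3 0 1 = C 0 1 0 3
    ∧ C 1 2 0 1 = C 0 1 1 2
    ∧ C 1 3 0 1 = C 0 1 1 3
    ∧ C 2 3 0 1 = C 0 1 2 3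
    ∧ C 0 3 0 2 = C 0 2 0 3
    ∧ C 1 2 0 2 = C 0 2 1 2
    ∧ C 1 3 0 2 = C 0 2 1 3
    ∧ C 2 3 0 2 = C 0 2 2 3
    ∧ C 1 2 0 3 = C 0 3 1 2
    ∧ C 1 3 0 3 = C 0 3 1 3
    ∧ C 2 3 0 3 = C 0 3 2 3
    ∧ C 1 3 1 2 = C 1 2 1 3
    ∧ C 2 3 1 2 = C 1 2 2 3
    ∧ C 2 3 1 3 = C 1 3 2 3 := by
  refine ⟨fun a c d => ?_, fun a b c => ?_, ?_⟩
  · linarith [hC.antisymm_left a a c d]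
  · linarith [hC.antisymm_right a b c c]
  · and_intros <;> first
      | exact hC.antisymm_left _ _
      | exact fun a b => hC.antisymm_right a b _ _
      | exact hC.symm_pair _ _ _ _

lemma weylOf_components (hE : ∀ a b, E a b = E b a) (hH : ∀ a b, H a b = H b a)
    (hE0 : ∀ a, E a 0 = 0) (hH0 : ∀ a, H a 0 = 0) :
    weylOf E H 0 1 0 1 = E 1 1
    ∧ weylOf E H 0 1 0 2 = E 1 2
    ∧ weylOf E H 0 1 0 3 = E 1 3
    ∧ weylOf E H 0 1 1 2 = -H 1 3
    ∧ weylOf E H 0 1 1 3 = H 1 2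
    ∧ weylOf E H 0 1 2 3 = -H 1 1
    ∧ weylOf E H 0 2 0 2 = E 2 2
    ∧ weylOf E H 0 2 0 3 = E 2 3
    ∧ weylOf E H 0 2 1 2 = -H 2 3
    ∧ weylOf E H 0 2 1 3 = H 2 2
    ∧ weylOf E H 0 2 2 3 = -H 1 2
    ∧ weylOf E H 0 3 0 3 = E 3 3
    ∧ weylOf E H 0 3 1 2 = -H 3 3
    ∧ weylOf E H 0 3 1 3 = H 2 3
    ∧ weylOf E H 0 3 2 3 = -H 1 3
    ∧ weylOf E H 1 2 1 2 = E 1 1 + E 2 2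
    ∧ weylOf E H 1 2 1 3 = E 2 3
    ∧ weylOf E H 1 2 2 3 = -E 1 3
    ∧ weylOf E H 1 3 1 3 = E 1 1 + E 3 3
    ∧ weylOf E H 1 3 2 3 = E 1 2
    ∧ weylOf E H 2 3 2 3 = E 2 2 + E 3 3 := by
  have hE0' (a) : E 0 a = 0 := by rw [hE, hE0]
  have hH0' (a) : H 0 a = 0 := by rw [hH, hH0]
  have u : uLow 0 = -1 ∧ uLow 1 = 0 ∧ uLow 2 = 0 ∧ uLow 3 = 0 := by simp [uLow, uUp, eta]
  simp only [weylOf, Fin.sum_univ_four, hLow, u, eta, hE0, hE0', hH0, hH0', eps_eq]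
  simp
  norm_num
  exact ⟨hH 2 1, hH 3 2, hH 3 1, add_comm _ _, add_comm _ _, add_comm _ _⟩
end JRB

/-! ### Electric and magnetic parts, and the trace-reversed field equations. -/

namespace JRB

variable {E H S T : Fin 4 → Fin 4 → ℝ} {C R : Fin 4 → Fin 4 → Fin 4 → Fin 4 → ℝ}

lemma electric_eq (C : Fin 4 → Fin 4 → Fin 4 → Fin 4 → ℝ) (a b : Fin 4) :
    electric C a b = C a 0 b 0 := by
  simp [electric, uUp]

lemma magnetic_eq (C : Fin 4 → Fin 4 → Fin 4 → Fin 4 → ℝ) (a b : Fin 4) :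
    magnetic C a b = (1 / 2) * ∑ m, ∑ n, eps a m n * eta m m * eta n n * C m n b 0 := by
  have h (c d : Fin 4) : ∑ e, ∑ f, ∑ m, ∑ n,
      leviCivita a c m n * eta m e * eta n f * C e f b d * uUp c * uUp d
      = ∑ m, ∑ n, leviCivita a c m n * eta m m * eta n n * C m n b d * uUp c * uUp d := by
    refine Finset.sum_congr rfl fun e _ => Finset.sum_congr rfl fun f _ => ?_
    rw [Finset.sum_eq_single e, Finset.sum_eq_single f]
    · intro n _ hn
      simp [eta, hn]
    · simp
    · intro m _ hm
      simp [eta, hm]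
    · simp
  simp only [magnetic, h]
  simp [uUp, leviCivita_zero_second]

lemma IsBivectorForm.magnetic_components (hC : IsBivectorForm C) (b : Fin 4) :
    magnetic C 0 b = 0 ∧ magnetic C 1 b = C 2 3 b 0 ∧ magnetic C 2 b = -C 1 3 b 0
      ∧ magnetic C 3 b = C 1 2 b 0 := by
  have o := hC.ordered
  simp only [magnetic_eq, Fin.sum_univ_four, eps_eq, eta]
  simp [o]
  norm_num
  refine ⟨?_, ?_, ?_⟩ <;> ring

lemma trace_weylOf (hE : ∀ a b, E a b = E b a) (hH : ∀ a b, H a b = H b a)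
    (hE0 : ∀ a, E a 0 = 0) (hH0 : ∀ a, H a 0 = 0) (trE : trace2 E = 0) (b d : Fin 4) :
    ∑ c, eta c c * weylOf E H c b c d = 0 := by
  have o := (isBivectorForm_weylOf (H := H) hE).ordered
  have w := weylOf_components hE hH hE0 hH0
  have t : E 1 1 + E 2 2 + E 3 3 = 0 := by
    simpa [trace2, Fin.sum_univ_four, eta, hE0] using trE
  simp only [Fin.sum_univ_four, eta]
  fin_cases b <;> fin_cases d <;> simp [o, w] <;> linarith

lemma electric_weylOf (hE : ∀ a b, E a b = E b a) (hH : ∀ a b, H a b = H b a)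
    (hE0 : ∀ a, E a 0 = 0) (hH0 : ∀ a, H a 0 = 0) : electric (weylOf E H) = E := by
  have o := (isBivectorForm_weylOf (H := H) hE).ordered
  have w := weylOf_components hE hH hE0 hH0
  have hE0' (a) : E 0 a = 0 := by rw [hE, hE0]
  funext a b
  rw [electric_eq]
  fin_cases a <;> fin_cases b <;> simp [o, w, hE0, hE0', hE 2 1, hE 3 1, hE 3 2]

lemma magnetic_weylOf (hE : ∀ a b, E a b = E b a) (hH : ∀ a b, H a b = H b a)
    (hE0 : ∀ a, E a 0 = 0) (hH0 : ∀ a, H a 0 = 0) : magnetic (weylOf E H) = H := by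
  have hW := isBivectorForm_weylOf (H := H) hE
  have o := hW.ordered
  have w := weylOf_components hE hH hE0 hH0
  have hH0' (a) : H 0 a = 0 := by rw [hH, hH0]
  funext a b
  obtain ⟨m0, m1, m2, m3⟩ := hW.magnetic_components b
  fin_cases a <;> simp only [Fin.zero_eta, Fin.mk_one, Fin.reduceFinMk, m0, m1, m2, m3] <;>
    fin_cases b <;> simp [o, w, hH0, hH0', hH 2 1, hH 3 1, hH 3 2]

/-- A trace-free tensor with the symmetries of a Riemann tensor is determined by its electric and
magnetic parts. -/
lemma IsBivectorForm.eq_weylOf (hC : IsBivectorForm C)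
    (cyc : C 0 1 2 3 + C 0 2 3 1 + C 0 3 1 2 = 0)
    (tr : ∀ b d, ∑ c, eta c c * C c b c d = 0) :
    C = weylOf (electric C) (magnetic C) := by
  have o := hC.ordered
  have hm := hC.magnetic_components
  have tr' (b d) := tr b d
  simp only [Fin.sum_univ_four, eta] at tr'
  have t00 := tr' 0 0
  have t01 := tr' 0 1
  have t02 := tr' 0 2
  have t03 := tr' 0 3
  have t11 := tr' 1 1
  have t12 := tr' 1 2
  have t13 := tr' 1 3
  have t22 := tr' 2 2
  have t23 := tr' 2 3
  have t33 := tr' 3 3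
  clear tr' tr
  simp [o] at t00 t01 t02 t03 t11 t12 t13 t22 t23 t33 cyc
  have hE (a b) : electric C a b = electric C b a := by
    rw [electric_eq, electric_eq, hC.symm_pair]
  have hE0 (a) : electric C a 0 = 0 := by rw [electric_eq, o.2.1]
  have hH0 (a) : magnetic C a 0 = 0 := by
    fin_cases a <;> simp [hm, o]
  have hH (a b) : magnetic C a b = magnetic C b a := by
    fin_cases a <;> fin_cases b <;> simp [hm, o] <;> linarith
  have w := weylOf_components hE hH hE0 hH0
  simp only [hm, electric_eq] at w
  funext a b c d
  rw [← sub_eq_zero]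
  apply (hC.sub (isBivectorForm_weylOf (E := electric C) (H := magnetic C) hE)).eq_zero <;>
    simp [w, o] <;> linarith

lemma ricciOf_symm (hT : ∀ a b, T a b = T b a) (a b : Fin 4) : ricciOf T a b = ricciOf T b a := by
  rw [ricciOf, ricciOf, hT, eta_comm]

lemma lower_raise (C : Fin 4 → Fin 4 → Fin 4 → Fin 4 → ℝ) : lower (raise C) = C := by
  funext a b c d
  rw [lower_eq]
  change eta a a * (∑ e, eta a e * C e b c d) = _
  rw [sum_eta_mul a fun e => C e b c d, ← mul_assoc, eta_mul_self, one_mul]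

lemma raise_lower (C : Fin 4 → Fin 4 → Fin 4 → Fin 4 → ℝ) : raise (lower C) = C :=
  lower_raise C

lemma ricci_raise (C : Fin 4 → Fin 4 → Fin 4 → Fin 4 → ℝ) (b d : Fin 4) :
    ricci (raise C) b d = ∑ c, eta c c * C c b c d := by
  simp only [ricci, raise]
  exact Finset.sum_congr rfl fun c _ => sum_eta_mul c fun e => C e b c d

lemma einsteinEq_iff : EinsteinEq R T ↔ ricci R = ricciOf T := by
  -- In dimension four `trace2 eta = 4`, so trace reversal changes the sign of the trace and is an
  -- involution.
  have htr (S : Fin 4 → Fin 4 → ℝ) (t : ℝ) :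
      trace2 (fun a b => S a b - 1 / 2 * t * eta a b) = trace2 S - 2 * t := by
    simp only [trace2, Fin.sum_univ_four, eta]
    simp
    ring
  constructor
  · intro h
    have hT : T = fun a b => ricci R a b - 1 / 2 * trace2 (ricci R) * eta a b :=
      funext₂ fun a b => (h a b).symm
    funext a b
    rw [ricciOf, hT, htr]
    ring
  · intro h a b
    have h' : trace2 (ricci R) = - trace2 T := by
      rw [h]
      refine (htr T (trace2 T)).trans ?_
      ring
    rw [h', h, ricciOf]
    ring

end JRB

/-! ### The difference of two curvature tensors at a generic point. -/

namespace JRB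

/-- By `h1` and symmetry `P = λ v vᵀ`. Then `h2` says that `λ (K v) vᵀ` is symmetric, so `K v` is
parallel to `v` unless `λ = 0`. -/
lemma eq_zero_of_not_eigenvector {v : Fin 3 → ℝ} {K P : Fin 3 → Fin 3 → ℝ}
    (hP : ∀ m n, P m n = P n m) (h1 : ∀ i m n, v i * P m n = v m * P i n)
    (h2 : ∀ i m, ∑ n, K i n * P m n = ∑ n, K m n * P i n) (hv : v ≠ 0)
    (hK : ¬ ∃ μ : ℝ, ∀ i, ∑ n, K i n * v n = μ * v i) (m n : Fin 3) : P m n = 0 := by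
  obtain ⟨i, hi⟩ : ∃ i, v i ≠ 0 := by
    by_contra! h
    exact hv (funext h)
  -- Here `λ = P i i / v i ^ 2`, written without division.
  have h (m n : Fin 3) : v i ^ 2 * P m n = P i i * (v m * v n) := by
    linear_combination v i * h1 i m n + v m * v i * hP i n + v m * h1 i n i
  have hPi : P i i = 0 := by
    by_contra hne
    refine hK ⟨(∑ n, K i n * v n) / v i, fun m => ?_⟩
    have h3 := congrArg (v i ^ 2 * ·) (h2 m i)
    simp only [Finset.mul_sum, mul_left_comm (v i ^ 2), h] at h3
    have h4 : (v i * P i i) * ∑ n, K m n * v n = (v m * P i i) * ∑ n, K i n * v n := by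
      rw [Finset.mul_sum, Finset.mul_sum]
      calc _ = ∑ n, K m n * (P i i * (v i * v n)) := by
            exact Finset.sum_congr rfl fun n _ => by ring
        _ = _ := h3
        _ = _ := Finset.sum_congr rfl fun n _ => by ring
    have h5 : P i i * (v i * ∑ n, K m n * v n - v m * ∑ n, K i n * v n) = 0 := by
      linear_combination h4
    have h6 := (mul_eq_zero.1 h5).resolve_left hne
    field_simp
    linear_combination h6
  have := h m n
  rw [hPi, zero_mul] at this
  exact (mul_eq_zero.1 this).resolve_left (pow_ne_zero 2 hi)

/-- A symmetric form on bivectors which is orthogonal to `u` vanishes if it satisfies the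
contracted Bianchi equations for a matrix `K` such that `K u` is not an eigenvector of the spatial
part of `K`. -/
lemma IsBivectorForm.eq_zero_of_contraction {L : Fin 4 → Fin 4 → Fin 4 → Fin 4 → ℝ}
    (hL : IsBivectorForm L) (h0 : ∀ a c d, L a 0 c d = 0) {K : Fin 4 → Fin 4 → ℝ}
    (hK : ∀ a c d k,
      ∑ f, (K f k * L a f c d + K f c * L a f d k + K f d * L a f k c) = 0)
    (hv : (fun i : Fin 3 => K i.succ 0) ≠ 0)
    (hKv : ¬ ∃ μ : ℝ, ∀ i : Fin 3,
      ∑ n : Fin 3, K i.succ n.succ * K n.succ 0 = μ * K i.succ 0) :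
    L = 0 := by
  have o := hL.ordered
  have h0' (b c d) : L 0 b c d = 0 := by rw [hL.antisymm_left, h0, neg_zero]
  have h0r (a b d) : L a b 0 d = 0 := by rw [hL.symm_pair, h0']
  have h0r' (a b d) : L a b d 0 = 0 := by rw [hL.symm_pair, h0]
  -- `P` is the double dual of `L`: its indices `0, 1, 2` stand for the spatial bivectors `23`,
  -- `31`, `12`, whence the minus signs.
  have key := eq_zero_of_not_eigenvector (v := fun i => K i.succ 0)
    (K := fun i n => K i.succ n.succ)
    (P := ![![L 2 3 2 3, -L 1 3 2 3, L 1 2 2 3], ![-L 1 3 2 3, L 1 3 1 3, -L 1 2 1 3],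
      ![L 1 2 2 3, -L 1 2 1 3, L 1 2 1 2]]) ?_ ?_ ?_ hv hKv
  · have k00 := key 0 0
    have k01 := key 0 1
    have k02 := key 0 2
    have k11 := key 1 1
    have k12 := key 1 2
    have k22 := key 2 2
    simp at k00 k01 k02 k11 k12 k22
    funext a b c d
    apply hL.eq_zero <;> first | assumption | apply h0'
  · intro m n
    fin_cases m <;> fin_cases n <;> rfl
  -- With one form index timelike, orthogonality to `u` leaves only the contraction of `L` with the
  -- vector `K · 0`.
  · have e (a c d) := hK a c d 0
    simp only [Fin.sum_univ_four, h0, h0r, h0r'] at e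
    have e112 := e 1 1 2
    have e113 := e 1 1 3
    have e123 := e 1 2 3
    have e212 := e 2 1 2
    have e213 := e 2 1 3
    have e223 := e 2 2 3
    have e312 := e 3 1 2
    have e313 := e 3 1 3
    have e323 := e 3 2 3
    clear e hK
    simp [o] at e112 e113 e123 e212 e213 e223 e312 e313 e323
    intro i m n
    fin_cases i <;> fin_cases m <;> fin_cases n <;> simp <;> linarith
  -- The totally spatial form component is the antisymmetric part of `K P`.
  · have e (a) := hK a 1 2 3
    simp only [Fin.sum_univ_four, h0] at e
    have e1 := e 1
    have e2 := e 2
    have e3 := e 3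
    clear e hK
    simp [o] at e1 e2 e3
    intro i m
    simp only [Fin.sum_univ_three]
    fin_cases i <;> fin_cases m <;> simp <;> linarith

section Congruence

variable {M : Type*} [TopologicalSpace M] [ChartedSpace (EuclideanSpace ℝ (Fin 4)) M]
  {e : Fin 4 → ∀ x : M, TangentSpace (𝓡 4) x} {γ : M → Fin 4 → Fin 4 → Fin 4 → ℝ} {x : M}

lemma gradU_eq (a b : Fin 4) : gradU e γ x a b = conn γ x a 0 b := by
  simp [gradU, covD1, uUp]

lemma accel_eq (a : Fin 4) : accel e γ x a = conn γ x a 0 0 := by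
  simp [accel, gradU_eq, uUp]

lemma hMix_eq (a b : Fin 4) : hMix a b = if a = b then (if a = 0 then 0 else 1) else 0 := by
  fin_cases a <;> fin_cases b <;> simp [hMix, hLow, uLow, uUp, eta]

lemma shearVorticity_succ_succ (i n : Fin 3) : shearVorticity e γ x i.succ n.succ
    = conn γ x i.succ 0 n.succ - if i = n then 1 / 3 * expansion e γ x else 0 := by
  have hp (i n : Fin 3) : projGrad e γ x i.succ n.succ = conn γ x i.succ 0 n.succ := by
    simp only [projGrad, gradU_eq, sum_eta_mul, hMix_eq]
    simp [eta]
    simp [Fin.sum_univ_succ (n := 3)]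
  simp only [shearVorticity, Matrix.of_apply, shear, vorticity]
  rw [sum_eta_mul]
  simp only [hp]
  simp [eta, hLow, uLow, uUp]
  split_ifs <;> ring

lemma shearVorticity_zero_left (b : Fin 4) : shearVorticity e γ x 0 b = 0 := by
  simp only [shearVorticity, Matrix.of_apply, shear, vorticity, sum_eta_mul, projGrad, hMix_eq]
  fin_cases b <;> simp [hLow, uLow, uUp, eta]

lemma Generic.acceleration_ne_zero (h : Generic e γ x) (h00 : conn γ x 0 0 0 = 0) :
    (fun i : Fin 3 => conn γ x i.succ 0 0) ≠ 0 := by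
  intro h'
  refine h.1 (funext fun a => ?_)
  rw [accel_eq]
  refine Fin.cases ?_ (fun i => ?_) a
  · exact h00
  · exact congrFun h' i

/-- The spatial block of `∇u` differs from `σ + ω` by a third of the expansion times the identity,
which only shifts eigenvalues. -/
lemma Generic.not_eigenvector (h : Generic e γ x) (h00 : conn γ x 0 0 0 = 0) :
    ¬ ∃ μ : ℝ, ∀ i : Fin 3,
      ∑ n : Fin 3, conn γ x i.succ 0 n.succ * conn γ x n.succ 0 0 = μ * conn γ x i.succ 0 0 := by
  rintro ⟨μ, hμ⟩
  refine h.2 ⟨μ - 1 / 3 * expansion e γ x, Module.End.mem_eigenspace_iff.2 ?_, h.1⟩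
  funext a
  simp only [Matrix.toLin'_apply, Matrix.mulVec, dotProduct, accel_eq, Pi.smul_apply, smul_eq_mul]
  refine Fin.cases ?_ (fun i => ?_) a
  · simp [shearVorticity_zero_left, h00]
  · rw [Fin.sum_univ_succ, h00, mul_zero, zero_add]
    simp only [shearVorticity_succ_succ, sub_mul, Finset.sum_sub_distrib, hμ]
    simp

end Congruence

namespace IsTetrad

variable {M : Type*} [TopologicalSpace M] [ChartedSpace (EuclideanSpace ℝ (Fin 4)) M]
  [IsManifold (𝓡 4) ∞ M] {U : Set M} {x : M}
  {g : ∀ x : M, LinearMap.BilinForm ℝ (TangentSpace (𝓡 4) x)}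
  {e : Fin 4 → ∀ x : M, TangentSpace (𝓡 4) x} {γ : M → Fin 4 → Fin 4 → Fin 4 → ℝ}
  {R : M → Fin 4 → Fin 4 → Fin 4 → Fin 4 → ℝ}

/-- The vector `u` has constant length, so its derivatives are orthogonal to it. -/
lemma conn_zero_zero (he : IsTetrad U g e γ) (hx : x ∈ U) (b : Fin 4) : conn γ x 0 0 b = 0 := by
  have := he.conn_metric hx 0 0 b
  rw [eta_mul_self] at this
  linarith

lemma isBivectorForm_curv (he : IsTetrad U g e γ) (hU : IsOpen U) (hx : x ∈ U) :
    IsBivectorForm (lower (curv e γ x)) :=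
  have h := he.isCurvatureLike_curv hU
  ⟨h.antisymm_left x hx, h.antisymm_right x hx, h.symm_pair x hx⟩

lemma ricciRes_eq (he : IsTetrad U g e γ) (hx : x ∈ U) (a c d : Fin 4) :
    ricciRes e γ R a c d x = curv e γ x a 0 d c - R x a 0 d c := by
  rw [ricciRes, he.ricci_identity hx]
  simp [uUp]

/-- Where the congruence is generic, a tensor field satisfying the Ricci equations for `u` to first
order and the Bianchi equations coincides with the curvature tensor. -/
lemma eq_curv (he : IsTetrad U g e γ) (hU : IsOpen U) (hx : x ∈ U) (hgen : Generic e γ x)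
    (hs : ∀ a b c d, ContMDiffOn (𝓡 4) 𝓘(ℝ, ℝ) ∞ (fun y => R y a b c d) U)
    (hR : IsBivectorForm (lower (R x)))
    (hric : ∀ a c d, ricciRes e γ R a c d x = 0)
    (hdric : ∀ k a c d, dirD e k (ricciRes e γ R a c d) x = 0)
    (hbi : ∀ a b c d k, bianchiRes e γ R a b c d k x = 0) : R x = curv e γ x := by
  have h0 (a c d : Fin 4) : R x a 0 c d = curv e γ x a 0 c d := by
    linarith [hric a d c, he.ricciRes_eq (R := R) hx a d c]
  -- The residual of the Ricci equations is a component of `curv - R` throughout `U`, so its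
  -- derivatives compare the derivatives of the two tensors.
  have hd0 (k a c d : Fin 4) : dirD e k (fun y => R y a 0 c d) x
      = dirD e k (fun y => curv e γ y a 0 c d) x := by
    have h := hdric k a d c
    have h' : ricciRes e γ R a d c =ᶠ[nhds x] fun y => curv e γ y a 0 c d - R y a 0 c d := by
      filter_upwards [hU.mem_nhds hx] with y hy using he.ricciRes_eq hy a d c
    rw [dirD_congr e k h', dirD_sub e k
      (mdifferentiableAt_of_contMDiffOn hU hx (he.contMDiffOn_curv hU a 0 c d))
      (mdifferentiableAt_of_contMDiffOn hU hx (hs a 0 c d))] at h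
    linarith
  have hC := he.isBivectorForm_curv hU hx
  have hL := hR.sub hC
  -- Every term with the second index still equal to `0` agrees for both tensors; only the
  -- connection term replacing that index survives.
  have hcov (a c d k : Fin 4) : covD13 e γ R x a 0 c d k - covD13 e γ (curv e γ) x a 0 c d k
      = - ∑ f, conn γ x f 0 k * (R x a f c d - curv e γ x a f c d) := by
    simp only [covD13, hd0, h0, Fin.sum_univ_four]
    ring
  have hbi' (a c d k : Fin 4) := (hbi a 0 c d k).trans (he.bianchi_second_curv hU hx a 0 c d k).symm
  have hlow (a f c d : Fin 4) : lower (R x) a f c d - lower (curv e γ x) a f c d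
      = eta a a * (R x a f c d - curv e γ x a f c d) := by
    rw [lower_eq, lower_eq]
    ring
  have h := hL.eq_zero_of_contraction (K := fun a b => conn γ x a 0 b) ?_ ?_
    (hgen.acceleration_ne_zero (he.conn_zero_zero hx 0))
    (hgen.not_eigenvector (he.conn_zero_zero hx 0))
  · rw [← raise_lower (R x), ← raise_lower (curv e γ x)]
    congr 1
    funext a b c d
    exact sub_eq_zero.1 (congrFun₂ (congrFun₂ h a b) c d)
  · intro a c d
    simp only [hlow, h0, sub_self, mul_zero]
  · intro a c d k
    have hanti (f c d : Fin 4) : R x a f c d - curv e γ x a f c d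
        = - (R x a f d c - curv e γ x a f d c) := by
      have := hL.antisymm_right a f c d
      simp only [hlow] at this
      have s := eta_mul_self a
      linear_combination eta a a * this - (R x a f c d - curv e γ x a f c d
        + (R x a f d c - curv e γ x a f d c)) * s
    have hb := hbi' a c d k
    simp only [bianchiRes, alt3] at hb
    have c1 := hcov a c d k
    have c2 := hcov a d k c
    have c3 := hcov a k c d
    have c4 := hcov a d c k
    have c5 := hcov a c k d
    have c6 := hcov a k d c
    -- Antisymmetry in the last pair turns the three odd permutations in `alt3` into the three
    -- cyclic ones.
    simp only [hanti _ d c, mul_neg, Finset.sum_neg_distrib] at c4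
    simp only [hanti _ c k, mul_neg, Finset.sum_neg_distrib] at c5
    simp only [hanti _ k d, mul_neg, Finset.sum_neg_distrib] at c6
    simp only [hlow, mul_left_comm _ (eta a a), ← mul_add, ← Finset.mul_sum,
      Finset.sum_add_distrib]
    refine mul_eq_zero_of_right _ ?_
    linarith

end IsTetrad

end JRB

/-! ### Passing between the curvature tensor and the variables `E`, `H`, `T`. -/

namespace JRB

section RiemannOf

variable {E H T : Fin 4 → Fin 4 → ℝ}

lemma lower_riemannOf : lower (riemannOf E H T)
    = fun a b c d => weylOf E H a b c d + ricciPart (ricciOf T) a b c d :=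
  lower_raise _

lemma isBivectorForm_riemannOf (hE : ∀ a b, E a b = E b a) (hT : ∀ a b, T a b = T b a) :
    IsBivectorForm (lower (riemannOf E H T)) := by
  rw [lower_riemannOf]
  exact (isBivectorForm_weylOf hE).add (isBivectorForm_ricciPart (ricciOf_symm hT))

lemma ricci_riemannOf (hE : ∀ a b, E a b = E b a) (hH : ∀ a b, H a b = H b a)
    (hT : ∀ a b, T a b = T b a) (hE0 : ∀ a, E a 0 = 0) (hH0 : ∀ a, H a 0 = 0)
    (trE : trace2 E = 0) : ricci (riemannOf E H T) = ricciOf T := by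
  funext b d
  rw [riemannOf, ricci_raise]
  simp only [mul_add, Finset.sum_add_distrib]
  rw [trace_weylOf hE hH hE0 hH0 trE, trace_ricciPart (ricciOf_symm hT), zero_add]

lemma weyl_riemannOf (hE : ∀ a b, E a b = E b a) (hH : ∀ a b, H a b = H b a)
    (hT : ∀ a b, T a b = T b a) (hE0 : ∀ a, E a 0 = 0) (hH0 : ∀ a, H a 0 = 0)
    (trE : trace2 E = 0) : weyl (riemannOf E H T) = weylOf E H := by
  funext a b c d
  rw [weyl, ricci_riemannOf hE hH hT hE0 hH0 trE, lower_riemannOf]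
  ring

/-- A tensor with the symmetries of a Riemann tensor is recovered from its Ricci tensor and the
electric and magnetic parts of its Weyl tensor. -/
lemma eq_riemannOf {R : Fin 4 → Fin 4 → Fin 4 → Fin 4 → ℝ} (hR : IsBivectorForm (lower R))
    (hcyc : ∀ a b c d, R a b c d + R a c d b + R a d b c = 0)
    (hric : ricci R = ricciOf T) (hT : ∀ a b, T a b = T b a) :
    R = riemannOf (electric (weyl R)) (magnetic (weyl R)) T := by
  have hS := ricciOf_symm hT
  have hP := isBivectorForm_ricciPart hS
  have hW : weyl R = fun a b c d => lower R a b c d - ricciPart (ricciOf T) a b c d := by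
    funext a b c d
    rw [weyl, hric]
  have h : weyl R = weylOf (electric (weyl R)) (magnetic (weyl R)) := by
    refine IsBivectorForm.eq_weylOf ?_ ?_ fun b d => ?_
    · rw [hW]
      exact hR.sub hP
    · have h3 := hcyc 0 1 2 3
      simp only [hW, lower_eq, ricciPart]
      simp [eta]
      linear_combination -h3
    · simp only [hW, mul_sub, Finset.sum_sub_distrib]
      rw [trace_ricciPart hS, ← hric, ← ricci_raise, raise_lower, sub_self]
  rw [riemannOf, ← h, ← raise_lower R]
  congr 1
  funext a b c d
  rw [raise_lower, weyl, hric]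
  ring

end RiemannOf

section System

variable {M : Type*} [TopologicalSpace M] [ChartedSpace (EuclideanSpace ℝ (Fin 4)) M]
  {U : Set M} {x : M} {e : Fin 4 → ∀ x : M, TangentSpace (𝓡 4) x}
  {γ : M → Fin 4 → Fin 4 → Fin 4 → ℝ}

/-- The Bianchi equations contain derivatives, so agreement is required near `x` and not only at
`x`. -/
lemma SystemAt.congr {R R' : M → Fin 4 → Fin 4 → Fin 4 → Fin 4 → ℝ} (hU : IsOpen U)
    (h : ∀ y ∈ U, R y = R' y) (hx : x ∈ U) (hR : SystemAt e γ R x) : SystemAt e γ R' x where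
  jacobi := hR.jacobi
  ricci a c d := by
    rw [← hR.ricci a c d, ricciRes, ricciRes, h x hx]
  bianchi a b c d k := by
    have hD (a b c d k : Fin 4) : dirD e k (fun y => R y a b c d) x
        = dirD e k (fun y => R' y a b c d) x := by
      apply dirD_congr
      filter_upwards [hU.mem_nhds hx] with y hy
      rw [h y hy]
    rw [← hR.bianchi a b c d k]
    simp only [bianchiRes, covD13, hD, h x hx]

namespace IsExtendedVars

variable {E H T : M → Fin 4 → Fin 4 → ℝ}

lemma apply_zero_E (h : IsExtendedVars U E H T) (hx : x ∈ U) (a : Fin 4) : E x a 0 = 0 := by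
  simpa [uUp] using h.orth_E x hx a

lemma apply_zero_H (h : IsExtendedVars U E H T) (hx : x ∈ U) (a : Fin 4) : H x a 0 = 0 := by
  simpa [uUp] using h.orth_H x hx a

lemma smooth_riemannOf (h : IsExtendedVars U E H T) (a b c d : Fin 4) :
    ContMDiffOn (𝓡 4) 𝓘(ℝ, ℝ) ∞ (fun y => riemannOf (E y) (H y) (T y) a b c d) U := by
  simp only [riemannOf, raise, weylOf, ricciPart, ricciOf, trace2]
  repeat' first
    | exact contMDiffOn_const
    | exact h.smooth_E _ _
    | exact h.smooth_H _ _
    | exact h.smooth_T _ _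
    | refine contMDiffOn_finsetSum fun _ _ => ?_
    | refine ContMDiffOn.sub ?_ ?_
    | refine ContMDiffOn.add ?_ ?_
    | refine ContMDiffOn.mul ?_ ?_

end IsExtendedVars

variable [IsManifold (𝓡 4) ∞ M] {g : ∀ x : M, LinearMap.BilinForm ℝ (TangentSpace (𝓡 4) x)}

namespace IsTetrad

variable {R : M → Fin 4 → Fin 4 → Fin 4 → Fin 4 → ℝ}

lemma systemAt_curv (he : IsTetrad U g e γ) (hU : IsOpen U) (hx : x ∈ U) :
    SystemAt e γ (curv e γ) x where
  jacobi d a b c := by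
    have h1 := he.jacobi hU hx d a b c
    have h2 := he.jacobi hU hx d b a c
    simp only [jacobiRes, alt3]
    linarith
  ricci := (he.isCurvatureLike_curv hU).ricci x hx
  bianchi := he.bianchi_second_curv hU hx

/-- Ricci equations valid on the open set `U` may be differentiated, which supplies the first-order
hypothesis of `eq_curv`. -/
lemma eq_curv_of_forall (he : IsTetrad U g e γ) (hU : IsOpen U) (hx : x ∈ U)
    (hgen : Generic e γ x)
    (hs : ∀ a b c d, ContMDiffOn (𝓡 4) 𝓘(ℝ, ℝ) ∞ (fun y => R y a b c d) U)
    (hR : IsBivectorForm (lower (R x)))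
    (hric : ∀ y ∈ U, ∀ a c d, ricciRes e γ R a c d y = 0)
    (hbi : ∀ a b c d k, bianchiRes e γ R a b c d k x = 0) : R x = curv e γ x := by
  refine he.eq_curv hU hx hgen hs hR (hric x hx) (fun k a c d => ?_) hbi
  rw [← dirD_const e k 0 x]
  apply dirD_congr
  filter_upwards [hU.mem_nhds hx] with y hy using hric y hy a c d

end IsTetrad

end System

end JRB

theorem theorem1 {M : Type*} [TopologicalSpace M] [ChartedSpace (EuclideanSpace ℝ (Fin 4)) M]
    [IsManifold (𝓡 4) ∞ M] (U : Set M) (hU : IsOpen U)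
    (g : ∀ x : M, LinearMap.BilinForm ℝ (TangentSpace (𝓡 4) x))
    (e : Fin 4 → ∀ x : M, TangentSpace (𝓡 4) x)
    (γ : M → Fin 4 → Fin 4 → Fin 4 → ℝ)
    (he : JRB.IsTetrad U g e γ)
    (hgen : ∀ x ∈ U, JRB.Generic e γ x) :
    -- every solution of the system on `U` satisfies the field equations; more precisely, the
    -- solutions are the solutions of the field equations in which `E` and `H` are the parts of
    -- the Weyl tensor
    (∀ E H T : M → Fin 4 → Fin 4 → ℝ, JRB.IsExtendedVars U E H T →
      ((∀ x ∈ U, JRB.SystemAt e γ (fun y => JRB.riemannOf (E y) (H y) (T y)) x) ↔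
        ∀ x ∈ U, JRB.EinsteinEq (JRB.curv e γ x) (T x) ∧
          E x = JRB.electric (JRB.weyl (JRB.curv e γ x)) ∧
          H x = JRB.magnetic (JRB.weyl (JRB.curv e γ x)))) ∧
    -- the field equations at a point are consequences of the system and of its first derivatives
    -- at that point
    (∀ E H T : M → Fin 4 → Fin 4 → ℝ, JRB.IsExtendedVars U E H T → ∀ x ∈ U,
      JRB.ProlongedSystemAt e γ (fun y => JRB.riemannOf (E y) (H y) (T y)) x →
        JRB.EinsteinEq (JRB.curv e γ x) (T x)) ∧
    -- the curvature tensor is the unique tensor with the stated properties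
    (JRB.IsCurvatureLike U e γ (JRB.curv e γ) ∧
      ∀ R : M → Fin 4 → Fin 4 → Fin 4 → Fin 4 → ℝ, JRB.IsCurvatureLike U e γ R →
        ∀ x ∈ U, R x = JRB.curv e γ x) := by

  refine ⟨fun E H T hv => ⟨fun hsys x hx => ?_, fun hE x hx => ?_⟩, fun E H T hv x hx hp => ?_,
    he.isCurvatureLike_curv hU, fun R hR x hx => ?_⟩
  -- Once `riemannOf` is identified with `curv`, its Ricci tensor and Weyl parts are read off
  -- algebraically.
  · have h := he.eq_curv_of_forall hU hx (hgen x hx) hv.smooth_riemannOf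
      (JRB.isBivectorForm_riemannOf (hv.symm_E x hx) (hv.symm_T x hx))
      (fun y hy => (hsys y hy).ricci) (hsys x hx).bianchi
    have hE0 := hv.apply_zero_E hx
    have hH0 := hv.apply_zero_H hx
    rw [← h, JRB.einsteinEq_iff, JRB.weyl_riemannOf (hv.symm_E x hx) (hv.symm_H x hx)
      (hv.symm_T x hx) hE0 hH0 (hv.trace_E x hx), JRB.electric_weylOf (hv.symm_E x hx)
      (hv.symm_H x hx) hE0 hH0, JRB.magnetic_weylOf (hv.symm_E x hx) (hv.symm_H x hx) hE0 hH0]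
    exact ⟨JRB.ricci_riemannOf (hv.symm_E x hx) (hv.symm_H x hx) (hv.symm_T x hx) hE0 hH0
      (hv.trace_E x hx), rfl, rfl⟩
  -- Conversely, `curv` solves the system, and the field equations with the given `E`, `H` identify
  -- it with `riemannOf` on all of `U`.
  · refine (he.systemAt_curv hU hx).congr hU (fun y hy => ?_) hx
    obtain ⟨h1, h2, h3⟩ := hE y hy
    rw [h2, h3]
    exact JRB.eq_riemannOf (he.isBivectorForm_curv hU hy) (he.curv_bianchi_first hU hy)
      (JRB.einsteinEq_iff.1 h1) (hv.symm_T y hy)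
  · have h := he.eq_curv hU hx (hgen x hx) hv.smooth_riemannOf
      (JRB.isBivectorForm_riemannOf (hv.symm_E x hx) (hv.symm_T x hx))
      hp.ricci hp.deriv_ricci hp.bianchi
    rw [← h, JRB.einsteinEq_iff]
    exact JRB.ricci_riemannOf (hv.symm_E x hx) (hv.symm_H x hx) (hv.symm_T x hx)
      (hv.apply_zero_E hx) (hv.apply_zero_H hx) (hv.trace_E x hx)
  · exact he.eq_curv_of_forall hU hx (hgen x hx) hR.smooth
      ⟨hR.antisymm_left x hx, hR.antisymm_right x hx, hR.symm_pair x hx⟩ hR.ricci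
      (hR.bianchi_second x hx)
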